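/- For $z_1=(x_1,y_1)$ and $z_2=(x_2,y_2)$ in $[0,1]^2$ let $h(z_1,z_2)=1$ if $(x_1-x_2)(y_1-y_2)<0$ and $h(z_1,z_2)=0$ otherwise. Let $\lambda^{\otimes 2}$ be Lebesgue measure on $[0,1]^2$. For $\beta\in\mathbb{R}$ and $n\ge 2$ put $$H_n(z_1,\dots,z_n)=\frac{1}{n-1}\sum_{1\le i<j\le n}h(z_i,z_j),\qquad Z_n(\beta)=\int_{([0,1]^2)^n}e^{-\beta H_n}\,d(\lambda^{\otimes 2})^{\otimes n},$$ $$p(\beta)=\lim_{n\to\infty}\frac1n\ln Z_n(\beta).$$ For a Borel probability measure $\nu$ on $[0,1]^2$ let $$\mathcal{E}(\nu)=\frac12\int\!\!\int h(z,w)\,d\nu(z)\,d\nu(w),$$ let $S(\nu|\lambda^{\otimes2})=-\int\ln\frac{d\nu}{d\lambda^{\otimes2}}\,d\nu$ if $\nu\ll\lambda^{\otimes2}$ (this may be $-\infty$), and $S(\nu|\lambda^{\otimes2})=-\infty$ otherwise, and let $$\mathcal{I}_\beta(\nu)=-\bigl(S(\nu|\lambda^{\otimes2})-\beta\,\mathcal{E}(\nu)-p(\beta)\bigr)\in(-\infty,+\infty].$$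 For $\theta_1,\theta_2\in[0,1]$ let $$R_\beta(\theta_1,\theta_2)=-\frac1\beta\ln\left(1-\frac{(1-e^{-\beta\theta_1})(1-e^{-\beta\theta_2})}{1-e^{-\beta}}\right)\quad(\beta\ne0),\qquad R_0(\theta_1,\theta_2)=\theta_1\theta_2,$$ the value at $\beta=0$ being the limit as $\beta\to0$. **Theorem.** For every $\beta\in\mathbb{R}$ the limit $p(\beta)$ exists in $\mathbb{R}$, the mixed partial derivative $\rho_\beta=\frac{\partial^2 R_\beta}{\partial x\,\partial y}$ exists and is nonnegative on $[0,1]^2$, and there is exactly one Borel probability measure $\nu$ on $[0,1]^2$ with $\mathcal{I}_\beta(\nu)=0$, namely the absolutely continuous measure $\nu=\nu_\beta^*$ given by $d\nu_\beta^*(x,y)=\rho_\beta(x,y)\,dx\,dy$. -/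

import Mathlib

open MeasureTheory Filter Topology

noncomputable section

namespace Mallows

/-- The unit square `[0,1]²`; its `volume` is the Lebesgue (probability) measure on it. -/
abbrev Square : Type := unitInterval × unitInterval

/-- The pair interaction `h((x₁,y₁),(x₂,y₂)) = 1` if `(x₁ - x₂)(y₁ - y₂) < 0`, and `0` otherwise. -/
def h (z w : Square) : ℝ :=
  Set.indicator (Set.Iio (0 : ℝ)) (fun _ => (1 : ℝ))
    (((z.1 : ℝ) - (w.1 : ℝ)) * ((z.2 : ℝ) - (w.2 : ℝ)))

/-- The Hamiltonian `H_n(z₁,…,z_n) = (n - 1)⁻¹ ∑_{i < j} h(z_i, z_j)`. -/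
def hamiltonian (n : ℕ) (z : Fin n → Square) : ℝ :=
  1 / ((n : ℝ) - 1) * ∑ i : Fin n, ∑ j ∈ Finset.Ioi i, h (z i) (z j)

/-- The partition function `Z_n(β)`, an integral over `([0,1]²)ⁿ` with respect to Lebesgue measure. -/
def partitionFunction (n : ℕ) (β : ℝ) : ℝ :=
  ∫ z : Fin n → Square, Real.exp (-β * hamiltonian n z) ∂(Measure.pi fun _ => volume)

/-- The finite-volume pressure `p_n(β) = n⁻¹ ln Z_n(β)`. -/
def finitePressure (n : ℕ) (β : ℝ) : ℝ :=
  1 / (n : ℝ) * Real.log (partitionFunction n β)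

/-- The pressure `p(β) = lim_{n → ∞} p_n(β)`. -/
def pressure (β : ℝ) : ℝ :=
  limUnder atTop fun n : ℕ => finitePressure n β

open Classical in
/-- The relative entropy `S(μ | ν) = -∫ ln(dμ/dν) dμ` if `μ ≪ ν`, and `-∞` otherwise, for
probability measures. If `μ ≪ ν`, then the negative part of `ln(dμ/dν)` is always `μ`-integrable,
so the integral is `+∞` (and `S(μ | ν) = -∞`) exactly when the logarithm is not integrable. -/
def relEntropy {α : Type*} [MeasurableSpace α] (μ ν : Measure α) : EReal :=
  if μ ≪ ν ∧ Integrable (fun x => Real.log (μ.rnDeriv ν x).toReal) μ then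
    ((-∫ x, Real.log (μ.rnDeriv ν x).toReal ∂μ : ℝ) : EReal)
  else ⊥

/-- The energy `𝓔(ν) = ½ ∫∫ h(z, w) dν(z) dν(w)`. -/
def energy (ν : Measure Square) : ℝ :=
  1 / 2 * ∫ z, ∫ w, h z w ∂ν ∂ν

/-- The rate function `𝓘_β(ν) = -(S(ν | λ²) - β 𝓔(ν) - p(β))`, with values in `(-∞, +∞]`. -/
def rateFunction (β : ℝ) (ν : ProbabilityMeasure Square) : EReal :=
  -(relEntropy (ν : Measure Square) volume - ((β * energy ν : ℝ) : EReal)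
      - ((pressure β : ℝ) : EReal))

/-- `R_β(x, y) = -β⁻¹ ln(1 - (1 - e^{-βx})(1 - e^{-βy}) / (1 - e^{-β}))` for `β ≠ 0`, and its limit
`R_0(x, y) = x y` as `β → 0`. -/
def R (β x y : ℝ) : ℝ :=
  if β = 0 then x * y
  else -(1 / β) * Real.log
    (1 - (1 - Real.exp (-β * x)) * (1 - Real.exp (-β * y)) / (1 - Real.exp (-β)))

/-- The mixed partial derivative `ρ_β = ∂²R_β/∂x∂y`. -/
def density (β x y : ℝ) : ℝ :=
  deriv (fun s => deriv (fun t => R β s t) y) x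

end Mallows

end

/-! The partition function is explicit. Permuting the first coordinates of the points does not change
Lebesgue measure, so `n! Z_n` is the generating function `∑_σ e^{-c inv σ}` of inversions, with
`c = β / (n - 1)` (`factorial_mul_integral`). This is a product of geometric sums
(`sum_exp_inversions`), and `n⁻¹ log Z_n` is a Riemann sum. With `E_β(t) = ∫₀ᵗ e^{-βs} ds` the result
is `p(β) = 1 + ∫₀¹ log E_β(t) dt` (`pressure_eq`).

The variational problem is not convex in `ν`, and it is solved by revealing the points in the order
of their first coordinates, as one does for the inversion table of a permutation. For a density `ρ`
let `g(x, y) = ∫₀ˣ ρ(s, y) ds`, let `G` be the distribution function of `ν` and `T` that of its first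
marginal. Counting every inverted pair at its right-hand point gives `𝓔(ν) = ∫ (T - G) dν`
(`energy_eq`). Consider the density, depending on `ν`,
`q = min(g, 1) e^{-β(T - G)} / E_β(T)`.
A distribution function without atoms pushes its measure forward to Lebesgue measure
(`map_measureReal_Iic`). Applied on vertical lines, this shows that `q` has total mass at most `1`;
applied on horizontal lines, it gives `∫ log (min(g, 1)) dν ≥ -1`, with equality only if the second
marginal is uniform; applied to the first marginal, it gives `∫ log E_β(T) dν = ∫₀¹ log E_β = p - 1`.
Hence
`-S(ν) + β 𝓔(ν) + p = (∫ log ρ dν - ∫ log q dν) + (1 + ∫ log (min(g, 1)) dν)`,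
and both brackets are nonnegative, the first by Gibbs' inequality (`gibbs_inequality`).

At a zero, `ρ = q` and the second marginal is uniform. Integrating `ρ = q` shows that the first
marginal is uniform and that `G` satisfies `∂G/∂x = e^{-βx} E_β(G) e^{βG} / E_β(x)`, so
`E_β(G) / E_β(x)` does not depend on `x` (`expInt_eq_mul_of_integral_eq`). The value at `x = 1` gives
`E_β(G) = E_β(x) E_β(y) / E_β(1)`, which is the equation `G = R_β` (`expInt_R`). Conversely
`ρ_β = e^{β(2R_β - x - y)} / E_β(1)` is its own reference density, so its rate function vanishes. -/

open scoped ENNReal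

noncomputable section

namespace Mallows

/-! ### The primitive of the exponential -/

/-- `E_β(t) = ∫₀ᵗ e^{-βs} ds`, which is `(1 - e^{-βt}) / β` for `β ≠ 0` and `t` for `β = 0`. -/
def expInt (β t : ℝ) : ℝ := ∫ s in (0 : ℝ)..t, Real.exp (-β * s)

lemma hasDerivAt_expInt (β t : ℝ) : HasDerivAt (expInt β) (Real.exp (-β * t)) t := by
  have hc : Continuous fun s : ℝ => Real.exp (-β * s) := by fun_prop
  exact intervalIntegral.integral_hasDerivAt_right (hc.intervalIntegrable _ _)
    (hc.stronglyMeasurableAtFilter _ _) hc.continuousAt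

lemma continuous_expInt (β : ℝ) : Continuous (expInt β) :=
  continuous_iff_continuousAt.2 fun t => (hasDerivAt_expInt β t).continuousAt

@[simp] lemma expInt_zero (β : ℝ) : expInt β 0 = 0 := by simp [expInt]

lemma strictMono_expInt (β : ℝ) : StrictMono (expInt β) :=
  strictMono_of_deriv_pos fun t => by rw [(hasDerivAt_expInt β t).deriv]; exact Real.exp_pos _

lemma expInt_pos (β : ℝ) {t : ℝ} (ht : 0 < t) : 0 < expInt β t := by
  simpa using strictMono_expInt β ht

lemma expInt_nonneg (β : ℝ) {t : ℝ} (ht : 0 ≤ t) : 0 ≤ expInt β t := by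
  simpa using (strictMono_expInt β).monotone ht

lemma hasDerivAt_exp_mul (c t : ℝ) :
    HasDerivAt (fun s => Real.exp (c * s)) (c * Real.exp (c * t)) t := by
  have := ((hasDerivAt_id t).const_mul c).exp
  simpa [mul_comm] using this

lemma mul_expInt (β t : ℝ) : β * expInt β t = 1 - Real.exp (-β * t) := by
  have h : ∫ s in (0 : ℝ)..t, -β * Real.exp (-β * s) = Real.exp (-β * t) - Real.exp (-β * 0) :=
    intervalIntegral.integral_eq_sub_of_hasDerivAt (fun s _ => hasDerivAt_exp_mul (-β) s)
      ((by fun_prop : Continuous fun s : ℝ => -β * Real.exp (-β * s)).intervalIntegrable _ _)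
  rw [intervalIntegral.integral_const_mul] at h
  simp only [mul_zero, Real.exp_zero] at h
  rw [expInt]; linarith

lemma integral_exp_sub (β : ℝ) (T t : ℝ) :
    ∫ u in (0 : ℝ)..t, Real.exp (-β * (T - u)) =
      Real.exp (-β * T) * (expInt β t * Real.exp (β * t)) := by
  have h (u : ℝ) : HasDerivAt
      (fun u => Real.exp (-β * T) * (expInt β u * Real.exp (β * u)))
      (Real.exp (-β * (T - u))) u := by
    have := (((hasDerivAt_expInt β u).mul (hasDerivAt_exp_mul β u)).const_mul (Real.exp (-β * T)))
    refine this.congr_deriv ?_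
    have e : Real.exp (-β * u) * Real.exp (β * u) = 1 := by rw [← Real.exp_add]; simp
    have e2 : Real.exp (-β * (T - u)) = Real.exp (-β * T) * Real.exp (β * u) := by
      rw [← Real.exp_add]; congr 1; ring
    rw [e2, e]
    have := mul_expInt β u
    linear_combination (Real.exp (-β * T) * Real.exp (β * u)) * this
      - Real.exp (-β * T) * e
  rw [intervalIntegral.integral_eq_sub_of_hasDerivAt (fun u _ => h u)
    ((by fun_prop : Continuous fun u : ℝ => Real.exp (-β * (T - u))).intervalIntegrable _ _)]
  simp

/-- The function `φ(t) = (1 - e^{-t}) / t`, with `φ(0) = 1`, written as `∫₀¹ e^{-ts} ds`. -/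
def phi (t : ℝ) : ℝ := expInt t 1

lemma phi_pos (t : ℝ) : 0 < phi t := expInt_pos t one_pos

lemma continuous_phi : Continuous phi := by
  unfold phi expInt
  exact intervalIntegral.continuous_parametric_intervalIntegral_of_continuous'
    (by fun_prop) 0 1

lemma expInt_eq_mul_phi (β t : ℝ) : expInt β t = t * phi (β * t) := by
  have := intervalIntegral.mul_integral_comp_mul_left (a := 0) (b := 1)
    (f := fun s : ℝ => Real.exp (-β * s)) t
  simp only [mul_zero, mul_one] at this
  rw [expInt, ← this, phi, expInt]
  congr 2
  ext s; congr 1; ring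

lemma continuous_log_phi (β : ℝ) : Continuous fun t => Real.log (phi (β * t)) :=
  (continuous_phi.comp (continuous_const.mul continuous_id)).log fun _ => (phi_pos _).ne'

lemma log_expInt (β : ℝ) {t : ℝ} (ht : 0 < t) :
    Real.log (expInt β t) = Real.log t + Real.log (phi (β * t)) := by
  rw [expInt_eq_mul_phi, Real.log_mul ht.ne' (phi_pos _).ne']

lemma intervalIntegrable_log_expInt (β : ℝ) :
    IntervalIntegrable (fun t => Real.log (expInt β t)) volume 0 1 := by
  refine IntervalIntegrable.congr (f := fun t => Real.log t + Real.log (phi (β * t))) ?_ ?_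
  · intro t ht
    rw [Set.uIoc_of_le zero_le_one] at ht
    exact (log_expInt β ht.1).symm
  · exact intervalIntegral.intervalIntegrable_log'.add
      ((continuous_log_phi β).intervalIntegrable _ _)

lemma integral_log_phi (β : ℝ) :
    ∫ t in (0 : ℝ)..1, Real.log (phi (β * t)) =
      1 + ∫ t in (0 : ℝ)..1, Real.log (expInt β t) := by
  have h1 : ∫ t in (0 : ℝ)..1, Real.log (expInt β t) =
      ∫ t in (0 : ℝ)..1, (Real.log t + Real.log (phi (β * t))) := by
    refine intervalIntegral.integral_congr_ae (ae_of_all _ fun t ht => ?_)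
    rw [Set.uIoc_of_le zero_le_one] at ht
    exact log_expInt β ht.1
  rw [h1, intervalIntegral.integral_add intervalIntegral.intervalIntegrable_log'
    ((continuous_log_phi β).intervalIntegrable _ _), integral_log]
  simp

/-- The geometric sum `∑_{k < m} e^{-ck}` is a quotient of integrals of the exponential. -/
lemma sum_exp_mul_phi (c : ℝ) (m : ℕ) :
    (∑ k ∈ Finset.range m, Real.exp (-c * k)) * phi c = m * phi (c * m) := by
  rw [← expInt_eq_mul_phi]
  induction m with
  | zero => simp
  | succ m ih =>
    rw [Finset.sum_range_succ, add_mul, ih]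
    have hc : Continuous fun s : ℝ => Real.exp (-c * s) := by fun_prop
    have h1 : expInt c (m + 1 : ℕ) = expInt c m + ∫ s in (m : ℝ)..(m + 1 : ℕ), Real.exp (-c * s) :=
      (intervalIntegral.integral_add_adjacent_intervals (hc.intervalIntegrable _ _)
        (hc.intervalIntegrable _ _)).symm
    rw [h1]
    congr 1
    have h2 := intervalIntegral.integral_comp_add_left (a := 0) (b := 1)
      (fun s : ℝ => Real.exp (-c * s)) (m : ℝ)
    rw [add_zero] at h2
    rw [Nat.cast_add, Nat.cast_one, ← h2, phi, expInt, ← intervalIntegral.integral_const_mul]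
    congr 1; ext s; rw [← Real.exp_add]; congr 1; ring

/-- Riemann sums of a continuous function, with the nodes `(i + 1) / (n - 1)`. -/
lemma tendsto_riemann_sum {f : ℝ → ℝ} (hf : Continuous f) :
    Tendsto (fun n : ℕ => 1 / (n : ℝ) * ∑ i ∈ Finset.range n, f ((i + 1) / ((n : ℝ) - 1))) atTop
      (𝓝 (∫ t in (0 : ℝ)..1, f t)) := by
  have hu : UniformContinuousOn f (Set.Icc 0 2) :=
    isCompact_Icc.uniformContinuousOn_of_continuous hf.continuousOn
  rw [Metric.uniformContinuousOn_iff] at hu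
  rw [Metric.tendsto_atTop]
  intro ε hε
  obtain ⟨δ, hδ, H⟩ := hu (ε / 2) (by positivity)
  obtain ⟨N, hN⟩ := exists_nat_gt (2 / δ)
  refine ⟨N + 2, fun n hn => ?_⟩
  have hn2 : (2 : ℝ) ≤ n := by exact_mod_cast (by omega : 2 ≤ n)
  have hnN : (N : ℝ) + 2 ≤ n := by exact_mod_cast hn
  have hn0 : (0 : ℝ) < n := by linarith
  have hn1 : (0 : ℝ) < (n : ℝ) - 1 := by linarith
  have hsplit : ∫ t in (0 : ℝ)..1, f t =
      ∑ i ∈ Finset.range n, ∫ t in ((i : ℝ) / n)..(((i + 1 : ℕ) : ℝ) / n), f t := by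
    rw [intervalIntegral.sum_integral_adjacent_intervals
      (a := fun i : ℕ => (i : ℝ) / n) (fun k _ => hf.intervalIntegrable _ _)]
    simp [hn0.ne']
  have hterm : ∀ i ∈ Finset.range n,
      ‖1 / (n : ℝ) * f ((i + 1) / ((n : ℝ) - 1)) -
        ∫ t in ((i : ℝ) / n)..(((i + 1 : ℕ) : ℝ) / n), f t‖ ≤ ε / 2 * (1 / n) := by
    intro i hi
    have hin : (i : ℝ) + 1 ≤ n := by exact_mod_cast Finset.mem_range.1 hi
    have hlen : ((i + 1 : ℕ) : ℝ) / n - (i : ℝ) / n = 1 / n := by push_cast; ring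
    have hle : (i : ℝ) / n ≤ ((i + 1 : ℕ) : ℝ) / n := by
      rw [← sub_nonneg, hlen]; positivity
    have e : 1 / (n : ℝ) * f ((i + 1) / ((n : ℝ) - 1)) =
        ∫ t in ((i : ℝ) / n)..(((i + 1 : ℕ) : ℝ) / n), f ((i + 1) / ((n : ℝ) - 1)) := by
      rw [intervalIntegral.integral_const, hlen, smul_eq_mul]
    rw [e, ← intervalIntegral.integral_sub (by simp) (hf.intervalIntegrable _ _)]
    have hb := intervalIntegral.norm_integral_le_of_norm_le_const (C := ε / 2)
      (f := fun t => f ((i + 1) / ((n : ℝ) - 1)) - f t)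
      (a := (i : ℝ) / n) (b := ((i + 1 : ℕ) : ℝ) / n) ?_
    · rwa [hlen, abs_of_pos (by positivity)] at hb
    · intro t ht
      rw [Set.uIoc_of_le hle] at ht
      have hi0 : (0 : ℝ) ≤ i := by positivity
      have ht1 : (i : ℝ) < t * n := (div_lt_iff₀ hn0).1 ht.1
      have ht2 : t * n ≤ i + 1 := by
        have := (le_div_iff₀ hn0).1 ht.2
        push_cast at this; exact this
      have hnode : ((i : ℝ) + 1) / (n - 1) ≤ 2 := by
        rw [div_le_iff₀ hn1]; linarith
      have ht0 : 0 < t := by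
        by_contra hcon
        nlinarith
      have ht3 : t ≤ 1 := by
        by_contra hcon
        nlinarith
      refine (H _ ⟨by positivity, hnode⟩ t ⟨ht0.le, by linarith⟩ ?_).le
      have hdist : |((i : ℝ) + 1) / (n - 1) - t| ≤ 2 / (n - 1) := by
        have e2 : ((i : ℝ) + 1) / (n - 1) - t = ((i : ℝ) + 1 - t * (n - 1)) / (n - 1) := by
          field_simp
        rw [e2, abs_div, abs_of_pos hn1]
        gcongr
        rw [abs_le]; constructor <;> nlinarith
      refine lt_of_le_of_lt hdist ?_
      rw [div_lt_iff₀ hn1]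
      rw [div_lt_iff₀ hδ] at hN
      nlinarith
  rw [dist_eq_norm, hsplit, Finset.mul_sum, ← Finset.sum_sub_distrib]
  refine lt_of_le_of_lt (norm_sum_le_of_le _ hterm) ?_
  rw [Finset.sum_const, Finset.card_range, nsmul_eq_mul]
  have : (n : ℝ) * (ε / 2 * (1 / n)) = ε / 2 := by field_simp
  rw [this]; linarith

/-! ### The partition function -/

/-- The number of inversions of a permutation of `Fin n`, as a real number. -/
def inversions {n : ℕ} (σ : Equiv.Perm (Fin n)) : ℝ :=
  ∑ i : Fin n, ∑ j ∈ Finset.Ioi i, if σ j < σ i then (1 : ℝ) else 0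

/-- The permutation of `Fin (n + 1)` with value `p` at `0` and with the other values in the relative
order given by `e`. -/
def consPerm {n : ℕ} (p : Fin (n + 1)) (e : Equiv.Perm (Fin n)) : Equiv.Perm (Fin (n + 1)) :=
  Equiv.ofBijective (Fin.cons p (p.succAbove ∘ e) : Fin (n + 1) → Fin (n + 1)) <| by
    refine Finite.injective_iff_bijective.1 ?_
    rw [Fin.cons_injective_iff]
    refine ⟨?_, p.succAbove_right_injective.comp e.injective⟩
    rintro ⟨i, hi⟩
    exact p.succAbove_ne _ hi

@[simp] lemma consPerm_zero {n : ℕ} (p : Fin (n + 1)) (e : Equiv.Perm (Fin n)) :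
    consPerm p e 0 = p := rfl

@[simp] lemma consPerm_succ {n : ℕ} (p : Fin (n + 1)) (e : Equiv.Perm (Fin n)) (i : Fin n) :
    consPerm p e i.succ = p.succAbove (e i) := rfl

lemma consPerm_bijective (n : ℕ) : Function.Bijective
    (fun q : Fin (n + 1) × Equiv.Perm (Fin n) => consPerm q.1 q.2) := by
  rw [Fintype.bijective_iff_injective_and_card]
  constructor
  · rintro ⟨p, e⟩ ⟨p', e'⟩ h
    have h0 : p = p' := by simpa using congrArg (fun σ => σ 0) h
    subst h0
    have : e = e' := by
      ext i
      have h1 : p.succAbove (e i) = p.succAbove (e' i) := by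
        simpa using congrArg (fun σ => σ i.succ) h
      rw [p.succAbove_right_injective h1]
    rw [this]
  · simp [Fintype.card_perm, Nat.factorial_succ]

lemma inversions_consPerm {n : ℕ} (p : Fin (n + 1)) (e : Equiv.Perm (Fin n)) :
    inversions (consPerm p e) = p + inversions e := by
  unfold inversions
  rw [Fin.sum_univ_succ, Fin.sum_Ioi_zero]
  congr 1
  · change ∑ j, (if p.succAbove (e j) < p then (1 : ℝ) else 0) = p
    rw [Equiv.sum_comp e (fun k => if p.succAbove k < p then (1 : ℝ) else 0)]
    simp only [Fin.succAbove_lt_iff_castSucc_lt]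
    rw [Finset.sum_boole]
    congr 1
    have : (Finset.univ.filter fun k : Fin n => k.castSucc < p).map Fin.castSuccEmb =
        Finset.Iio p := by
      ext k
      simp only [Finset.mem_map, Finset.mem_filter, Finset.mem_univ, true_and, Finset.mem_Iio]
      constructor
      · rintro ⟨a, ha, rfl⟩; exact ha
      · intro hk
        exact ⟨k.castLT (by omega), by simpa using hk, by simp⟩
    rw [← Finset.card_map Fin.castSuccEmb, this, Fin.card_Iio]
  · refine Finset.sum_congr rfl fun i _ => ?_
    rw [Fin.sum_Ioi_succ]
    simp only [consPerm_succ, p.strictMono_succAbove.lt_iff_lt]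

/-- The generating function of the number of inversions is a product of geometric sums. -/
lemma sum_exp_inversions (c : ℝ) (n : ℕ) :
    ∑ σ : Equiv.Perm (Fin n), Real.exp (-c * inversions σ) =
      ∏ i ∈ Finset.range n, ∑ k ∈ Finset.range (i + 1), Real.exp (-c * k) := by
  induction n with
  | zero => simp [inversions]
  | succ n ih =>
    rw [Finset.prod_range_succ, ← ih, ← (consPerm_bijective n).sum_comp, Fintype.sum_prod_type,
      mul_comm, Finset.sum_mul_sum]
    rw [← Fin.sum_univ_eq_sum_range (fun k => ∑ j : Equiv.Perm (Fin n),
      Real.exp (-c * (k : ℝ)) * Real.exp (-c * inversions j))]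
    refine Finset.sum_congr rfl fun p _ => Finset.sum_congr rfl fun e _ => ?_
    rw [inversions_consPerm, ← Real.exp_add]
    congr 1; ring

lemma h_comm (z w : Square) : h z w = h w z := by
  unfold h; congr 1; ring

lemma h_self (z : Square) : h z z = 0 := by simp [h]

lemma measurable_h : Measurable fun q : Square × Square => h q.1 q.2 := by
  unfold h
  exact (measurable_const.indicator measurableSet_Iio).comp (by fun_prop)

/-- The number of inverted pairs `i < j`, for `n` points of the square. -/
def pairSum (n : ℕ) (z : Fin n → Square) : ℝ := ∑ i : Fin n, ∑ j ∈ Finset.Ioi i, h (z i) (z j)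

lemma sum_sum_eq_two_mul {n : ℕ} (f : Fin n → Fin n → ℝ) (hs : ∀ i j, f i j = f j i)
    (h0 : ∀ i, f i i = 0) : ∑ i, ∑ j, f i j = 2 * ∑ i : Fin n, ∑ j ∈ Finset.Ioi i, f i j := by
  have h1 (i : Fin n) : ∑ j, f i j = ∑ j ∈ Finset.Ioi i, f i j + ∑ j ∈ Finset.Iio i, f i j := by
    have h2 (j : Fin n) :
        f i j = (if i < j then f i j else 0) + (if j < i then f i j else 0) := by
      rcases lt_trichotomy i j with hij | hij | hij
      · simp [hij, hij.not_gt]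
      · subst hij; simp [h0]
      · simp [hij, hij.not_gt]
    rw [Finset.sum_congr rfl fun j _ => h2 j, Finset.sum_add_distrib, ← Finset.sum_filter,
      ← Finset.sum_filter]
    congr 2
    · ext; simp
    · ext; simp
  rw [Finset.sum_congr rfl fun i _ => h1 i, Finset.sum_add_distrib, two_mul]
  congr 1
  simp only [← Finset.filter_lt_eq_Ioi, ← Finset.filter_gt_eq_Iio,
    Finset.sum_filter]
  rw [Finset.sum_comm]
  simp only [hs]

lemma pairSum_comp_perm {n : ℕ} (z : Fin n → Square) (τ : Equiv.Perm (Fin n)) :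
    pairSum n (z ∘ τ) = pairSum n z := by
  have h1 (w : Fin n → Square) : 2 * pairSum n w = ∑ i, ∑ j, h (w i) (w j) :=
    (sum_sum_eq_two_mul (fun i j => h (w i) (w j)) (fun _ _ => h_comm _ _)
      fun _ => h_self _).symm
  have h2 : 2 * pairSum n (z ∘ τ) = 2 * pairSum n z := by
    rw [h1, h1]
    simp only [Function.comp]
    rw [Equiv.sum_comp τ (fun i => ∑ j, h (z i) (z (τ j)))]
    exact Finset.sum_congr rfl fun i _ => Equiv.sum_comp τ (fun j => h (z i) (z j))
  linarith

/-- Permute the first coordinates of `n` points of the square. -/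
def permFst {n : ℕ} (σ : Equiv.Perm (Fin n)) (z : Fin n → Square) : Fin n → Square :=
  fun i => ((z (σ i)).1, (z i).2)

lemma pairSum_strictMono {n : ℕ} {x y : Fin n → unitInterval} (hx : StrictMono x)
    (hy : StrictMono y) (σ : Equiv.Perm (Fin n)) :
    pairSum n (fun i => (x (σ i), y i)) = inversions σ := by
  unfold pairSum inversions
  refine Finset.sum_congr rfl fun i _ => Finset.sum_congr rfl fun j hj => ?_
  have hy' : (y i : ℝ) - y j < 0 := sub_neg.2 (Subtype.coe_lt_coe.2 (hy (Finset.mem_Ioi.1 hj)))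
  unfold h
  rw [Set.indicator_apply]
  refine if_congr ?_ rfl rfl
  rw [Set.mem_Iio, mul_neg_iff]
  have h3 : (0 : ℝ) < x (σ i) - x (σ j) ↔ σ j < σ i := by
    rw [sub_pos, Subtype.coe_lt_coe, hx.lt_iff_lt]
  constructor
  · rintro (h4 | h4)
    · exact h3.1 h4.1
    · linarith [h4.2]
  · intro h4; exact Or.inl ⟨h3.2 h4, hy'⟩

lemma exists_perm_strictMono {n : ℕ} {x : Fin n → unitInterval} (hx : Function.Injective x) :
    ∃ τ : Equiv.Perm (Fin n), StrictMono (x ∘ τ) :=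
  ⟨Tuple.sort x, (Tuple.monotone_sort x).strictMono_of_injective
    (hx.comp (Tuple.sort x).injective)⟩

lemma sum_perm_exp_pairSum {n : ℕ} (c : ℝ) (z : Fin n → Square)
    (hx : Function.Injective fun i => (z i).1) (hy : Function.Injective fun i => (z i).2) :
    ∑ σ : Equiv.Perm (Fin n), Real.exp (-c * pairSum n (permFst σ z)) =
      ∑ σ : Equiv.Perm (Fin n), Real.exp (-c * inversions σ) := by
  obtain ⟨π, hπ⟩ := exists_perm_strictMono hx
  obtain ⟨τ, hτ⟩ := exists_perm_strictMono hy
  have key (σ : Equiv.Perm (Fin n)) :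
      pairSum n (permFst σ z) = inversions (π⁻¹ * (σ * τ)) := by
    rw [← pairSum_strictMono hπ hτ, ← pairSum_comp_perm _ τ]
    congr 1; ext i <;> simp [permFst]
  simp only [key]
  exact Equiv.sum_comp ((Equiv.mulRight τ).trans (Equiv.mulLeft π⁻¹))
    fun σ => Real.exp (-c * inversions σ)

lemma measurePreserving_permFst {n : ℕ} (σ : Equiv.Perm (Fin n)) :
    MeasurePreserving (permFst σ) (Measure.pi fun _ : Fin n => (volume : Measure Square))
      (Measure.pi fun _ => volume) := by
  have h1 := measurePreserving_arrowProdEquivProdArrow unitInterval unitInterval (Fin n)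
    (fun _ => volume) (fun _ => volume)
  have h2 := measurePreserving_piCongrLeft (fun _ : Fin n => (volume : Measure unitInterval)) σ⁻¹
  have h3 := (h1.symm _).comp ((h2.prod (MeasurePreserving.id _)).comp h1)
  have h5 : permFst σ =
      (MeasurableEquiv.arrowProdEquivProdArrow unitInterval unitInterval (Fin n)).symm ∘
        Prod.map (MeasurableEquiv.piCongrLeft (fun _ => unitInterval) σ⁻¹) id ∘
        MeasurableEquiv.arrowProdEquivProdArrow unitInterval unitInterval (Fin n) := by
    funext z i
    refine Prod.ext ?_ rfl
    have h4 := Equiv.piCongrLeft_apply_apply (fun _ : Fin n => unitInterval) σ⁻¹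
      (fun k => (z k).1) (σ i)
    rw [show σ⁻¹ (σ i) = i from σ.symm_apply_apply i] at h4
    exact h4.symm
  rw [h5]
  exact h3

lemma ae_injective_coord (n : ℕ) (f : Square → unitInterval) (hf : MeasurePreserving f) :
    ∀ᵐ z ∂(Measure.pi fun _ : Fin n => (volume : Measure Square)),
      Function.Injective fun i => f (z i) := by
  set P := Measure.pi fun _ : Fin n => (volume : Measure Square)
  have hdiag : (volume.prod volume : Measure (unitInterval × unitInterval))
      {q | q.1 = q.2} = 0 := by
    rw [Measure.measure_prod_null (measurableSet_eq_fun measurable_fst measurable_snd)]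
    refine ae_of_all _ fun a => ?_
    have : Prod.mk a ⁻¹' {q : unitInterval × unitInterval | q.1 = q.2} = {a} := by
      ext b; simp [eq_comm]
    change volume (Prod.mk a ⁻¹' {q : unitInterval × unitInterval | q.1 = q.2}) = 0
    rw [this]; simp
  have hpair (i j : Fin n) (hij : i ≠ j) : ∀ᵐ z ∂P, f (z i) ≠ f (z j) := by
    have hind := (ProbabilityTheory.iIndepFun_pi (μ := fun _ : Fin n => (volume : Measure Square))
      (X := fun _ => f) fun _ => hf.measurable.aemeasurable).indepFun hij
    have hi (k : Fin n) : MeasurePreserving (fun z : Fin n → Square => f (z k)) P volume :=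
      hf.comp (measurePreserving_eval _ k)
    rw [ProbabilityTheory.indepFun_iff_map_prod_eq_prod_map_map (hi i).measurable.aemeasurable
      (hi j).measurable.aemeasurable, (hi i).map_eq, (hi j).map_eq] at hind
    rw [← hind, Measure.map_apply ((hi i).measurable.prodMk (hi j).measurable)
      (measurableSet_eq_fun measurable_fst measurable_snd)] at hdiag
    exact measure_eq_zero_iff_ae_notMem.1 hdiag
  have hall : ∀ᵐ z ∂P, ∀ i j : Fin n, i ≠ j → f (z i) ≠ f (z j) := by
    simp only [ae_all_iff]
    exact hpair
  filter_upwards [hall] with z hz i j hij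
  by_contra hne
  exact hz i j hne hij

lemma measurable_pairSum (n : ℕ) : Measurable (pairSum n) := by
  unfold pairSum
  refine Finset.measurable_sum _ fun i _ => Finset.measurable_sum _ fun j _ => ?_
  exact measurable_h.comp (f := fun z : Fin n → Square => (z i, z j)) (by fun_prop)

lemma h_nonneg (z w : Square) : 0 ≤ h z w :=
  Set.indicator_nonneg (fun _ _ => zero_le_one) _

lemma h_le_one (z w : Square) : h z w ≤ 1 :=
  Set.indicator_le_self' (fun _ _ => zero_le_one) _

lemma integrable_exp_pairSum (n : ℕ) (c : ℝ) : Integrable (fun z => Real.exp (-c * pairSum n z))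
    (Measure.pi fun _ : Fin n => (volume : Measure Square)) := by
  have hb (z : Fin n → Square) : |pairSum n z| ≤ n * n := by
    unfold pairSum
    rw [abs_of_nonneg (Finset.sum_nonneg fun i _ => Finset.sum_nonneg fun j _ => h_nonneg _ _)]
    calc ∑ i : Fin n, ∑ j ∈ Finset.Ioi i, h (z i) (z j)
        ≤ ∑ i : Fin n, ∑ j : Fin n, (1 : ℝ) := by
          refine Finset.sum_le_sum fun i _ => ?_
          refine (Finset.sum_le_sum fun j _ => h_le_one _ _).trans ?_
          exact Finset.sum_le_sum_of_subset_of_nonneg (Finset.subset_univ _) (by simp)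
      _ = n * n := by simp
  refine Integrable.of_bound (C := Real.exp (|c| * (n * n)))
    ((measurable_pairSum n).const_mul _).exp.aestronglyMeasurable (ae_of_all _ fun z => ?_)
  rw [Real.norm_eq_abs, Real.abs_exp, Real.exp_le_exp]
  refine (le_abs_self _).trans ?_
  rw [abs_mul, abs_neg]
  exact mul_le_mul_of_nonneg_left (hb z) (abs_nonneg _)

/-- The integral is unchanged when the first coordinates are permuted, and the sum of the integrands
over all permutations is almost everywhere constant. -/
lemma factorial_mul_integral (n : ℕ) (c : ℝ) :
    (n.factorial : ℝ) * ∫ z : Fin n → Square, Real.exp (-c * pairSum n z)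
        ∂(Measure.pi fun _ => volume) =
      ∑ σ : Equiv.Perm (Fin n), Real.exp (-c * inversions σ) := by
  set P := Measure.pi fun _ : Fin n => (volume : Measure Square)
  have h1 (σ : Equiv.Perm (Fin n)) : ∫ z, Real.exp (-c * pairSum n (permFst σ z)) ∂P =
      ∫ z, Real.exp (-c * pairSum n z) ∂P := by
    have h0 := integral_map (μ := P) (measurePreserving_permFst σ).measurable.aemeasurable
      (f := fun z => Real.exp (-c * pairSum n z))
      ((measurable_pairSum n).const_mul _).exp.aestronglyMeasurable
    rw [(measurePreserving_permFst σ).map_eq] at h0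
    exact h0.symm
  have h2 : ∫ z, ∑ σ : Equiv.Perm (Fin n), Real.exp (-c * pairSum n (permFst σ z)) ∂P =
      (n.factorial : ℝ) * ∫ z, Real.exp (-c * pairSum n z) ∂P := by
    rw [integral_finsetSum]
    · simp only [h1, Finset.sum_const, Finset.card_univ, Fintype.card_perm, Fintype.card_fin,
        nsmul_eq_mul]
    · intro σ _
      exact (measurePreserving_permFst σ).integrable_comp_of_integrable
        (integrable_exp_pairSum n c)
  rw [← h2]
  have h3 : (fun z => ∑ σ : Equiv.Perm (Fin n), Real.exp (-c * pairSum n (permFst σ z))) =ᵐ[P]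
      fun _ => ∑ σ : Equiv.Perm (Fin n), Real.exp (-c * inversions σ) := by
    filter_upwards [ae_injective_coord n Prod.fst measurePreserving_fst,
      ae_injective_coord n Prod.snd measurePreserving_snd] with z hx hy
    exact sum_perm_exp_pairSum c z hx hy
  rw [integral_congr_ae h3]
  simp

lemma partitionFunction_eq (n : ℕ) (β : ℝ) :
    partitionFunction n β = ∏ i ∈ Finset.range n,
      phi (β * ((i + 1) / ((n : ℝ) - 1))) / phi (β / ((n : ℝ) - 1)) := by
  have h1 : partitionFunction n β = ∫ z : Fin n → Square,
      Real.exp (-(β / ((n : ℝ) - 1)) * pairSum n z) ∂(Measure.pi fun _ => volume) := by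
    unfold partitionFunction hamiltonian pairSum
    congr 1; ext z; congr 1; ring
  set c := β / ((n : ℝ) - 1) with hc
  have h2 := factorial_mul_integral n c
  rw [← h1, sum_exp_inversions] at h2
  have h3 : (n.factorial : ℝ) = ∏ i ∈ Finset.range n, ((i : ℝ) + 1) := by
    rw [← Finset.prod_range_add_one_eq_factorial]; push_cast; rfl
  have h4 : (n.factorial : ℝ) ≠ 0 := by positivity
  refine mul_left_cancel₀ h4 ?_
  rw [h2, h3, ← Finset.prod_mul_distrib]
  refine Finset.prod_congr rfl fun i _ => ?_
  have h5 := sum_exp_mul_phi c (i + 1)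
  have h6 : c * ((i + 1 : ℕ) : ℝ) = β * ((i + 1) / ((n : ℝ) - 1)) := by
    rw [hc]; push_cast; ring
  rw [h6] at h5
  push_cast at h5
  rw [← mul_div_assoc, ← h5, mul_div_assoc, div_self (phi_pos _).ne', mul_one]

lemma tendsto_finitePressure (β : ℝ) : Tendsto (fun n : ℕ => finitePressure n β) atTop
    (𝓝 (∫ t in (0 : ℝ)..1, Real.log (phi (β * t)))) := by
  have h0 : Tendsto (fun n : ℕ => Real.log (phi (β * (1 / ((n : ℝ) - 1))))) atTop (𝓝 0) := by
    have h1 : Tendsto (fun n : ℕ => 1 / ((n : ℝ) - 1)) atTop (𝓝 0) :=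
      (tendsto_const_nhds (x := (1 : ℝ))).div_atTop
        (tendsto_atTop_add_const_right _ (-1) tendsto_natCast_atTop_atTop)
    have h2 := ((continuous_log_phi β).tendsto 0).comp h1
    have h3 : phi (β * 0) = 1 := by simp [phi, expInt]
    rw [h3, Real.log_one] at h2
    exact h2
  have h3 := (tendsto_riemann_sum (continuous_log_phi β)).sub h0
  rw [sub_zero] at h3
  refine h3.congr' ?_
  filter_upwards [eventually_gt_atTop 0] with n hn
  have hn' : (n : ℝ) ≠ 0 := by exact_mod_cast hn.ne'
  rw [finitePressure, partitionFunction_eq, Real.log_prod]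
  · simp only [Real.log_div (phi_pos _).ne' (phi_pos _).ne', Finset.sum_sub_distrib]
    simp [mul_sub, hn', div_eq_mul_inv]
  · intro i _; exact (div_pos (phi_pos _) (phi_pos _)).ne'

lemma pressure_eq (β : ℝ) :
    pressure β = 1 + ∫ t in (0 : ℝ)..1, Real.log (expInt β t) := by
  rw [← integral_log_phi]
  exact (tendsto_finitePressure β).limUnder_eq

/-! ### The probability integral transform on the unit interval -/

lemma continuous_measureReal_Iic (μ : Measure unitInterval) [IsFiniteMeasure μ]
    [NullSingletonClass μ] : Continuous fun x => μ.real (Set.Iic x) := by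
  have h1 (x : unitInterval) :
      μ.real (Set.Iic x) = ∫ s, (Set.Iic x).indicator (fun _ => (1 : ℝ)) s ∂μ := by
    rw [integral_indicator_const _ measurableSet_Iic]; simp
  simp only [h1]
  rw [continuous_iff_continuousAt]
  intro x₀
  refine continuousAt_of_dominated (bound := fun _ => 1) ?_ ?_ (integrable_const _) ?_
  · exact Eventually.of_forall fun x =>
      (measurable_const.indicator measurableSet_Iic).aestronglyMeasurable
  · refine Eventually.of_forall fun x => ae_of_all _ fun s => ?_
    by_cases hs : s ∈ Set.Iic x <;> simp [hs]
  · have h2 : ∀ᵐ s ∂μ, s ≠ x₀ := by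
      rw [ae_iff]; simp
    filter_upwards [h2] with s hs
    rcases lt_or_gt_of_ne hs with hlt | hgt
    · refine (continuousAt_const (y := (1 : ℝ))).congr ?_
      filter_upwards [lt_mem_nhds hlt] with x hx
      simp [hx.le]
    · refine (continuousAt_const (y := (0 : ℝ))).congr ?_
      filter_upwards [gt_mem_nhds hgt] with x hx
      simp [hx]

lemma monotone_measureReal_Iic (μ : Measure unitInterval) [IsFiniteMeasure μ] :
    Monotone fun x => μ.real (Set.Iic x) :=
  fun _ _ hxy => measureReal_mono (Set.Iic_subset_Iic.2 hxy)

/-- The distribution function of a finite measure without atoms pushes the measure forward to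
Lebesgue measure. -/
lemma map_measureReal_Iic (μ : Measure unitInterval) [IsFiniteMeasure μ] [NullSingletonClass μ] :
    μ.map (fun x => μ.real (Set.Iic x)) =
      (volume : Measure ℝ).restrict (Set.Icc 0 (μ.real Set.univ)) := by
  set F : unitInterval → ℝ := fun x => μ.real (Set.Iic x) with hF
  have hc : Continuous F := continuous_measureReal_Iic μ
  have hm : Monotone F := monotone_measureReal_Iic μ
  have h0 : F 0 = 0 := by
    have : Set.Iic (0 : unitInterval) = {0} := by
      ext a; exact ⟨fun ha => le_antisymm ha a.2.1, fun ha => le_of_eq ha⟩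
    simp [hF, this, measureReal_def]
  have h1 : F 1 = μ.real Set.univ := by
    have : Set.Iic (1 : unitInterval) = Set.univ := by
      ext a; simp [unitInterval.le_one']
    simp [hF, this]
  refine Measure.ext_of_Iic _ _ fun u => ?_
  rw [Measure.map_apply hc.measurable measurableSet_Iic,
    Measure.restrict_apply measurableSet_Iic]
  rcases lt_or_ge u 0 with hu | hu
  · have e1 : F ⁻¹' Set.Iic u = ∅ := by
      ext x
      simpa using hu.trans_le measureReal_nonneg
    have e2 : Set.Iic u ∩ Set.Icc 0 (μ.real Set.univ) = ∅ := by
      ext x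
      simp only [Set.mem_inter_iff, Set.mem_Iic, Set.mem_Icc, Set.mem_empty_iff_false, iff_false]
      rintro ⟨h3, h4, -⟩
      linarith
    rw [e1, e2]; simp
  rcases le_total (μ.real Set.univ) u with hmu | hmu
  · have e1 : F ⁻¹' Set.Iic u = Set.univ := by
      ext x
      simp only [Set.mem_preimage, Set.mem_Iic, Set.mem_univ, iff_true]
      exact (measureReal_mono (Set.subset_univ _)).trans hmu
    have e2 : Set.Iic u ∩ Set.Icc 0 (μ.real Set.univ) = Set.Icc 0 (μ.real Set.univ) := by
      refine Set.inter_eq_right.2 fun x hx => hx.2.trans hmu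
    rw [e1, e2]; simp
  · obtain ⟨x₁, hx₁⟩ : u ∈ Set.range F := by
      refine mem_range_of_exists_le_of_exists_ge hc ⟨0, ?_⟩ ⟨1, ?_⟩
      · rw [h0]; exact hu
      · rw [h1]; exact hmu
    -- The largest point with `F ≤ u`: `F` may be constant to the right of `x₁`.
    have hcpt : IsCompact (F ⁻¹' Set.Iic u) := (isClosed_Iic.preimage hc).isCompact
    obtain ⟨x₀, hx₀, hmax⟩ := hcpt.exists_isGreatest ⟨x₁, hx₁.le⟩
    have hFx₀ : F x₀ = u := le_antisymm hx₀ (hx₁ ▸ hm (hmax hx₁.le))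
    have e1 : F ⁻¹' Set.Iic u = Set.Iic x₀ := by
      ext x
      exact ⟨fun hx => hmax hx, fun hx => (hm hx).trans hx₀⟩
    have e2 : Set.Iic u ∩ Set.Icc 0 (μ.real Set.univ) = Set.Icc 0 u := by
      ext x
      simp only [Set.mem_inter_iff, Set.mem_Iic, Set.mem_Icc]
      constructor
      · rintro ⟨h3, h4, -⟩; exact ⟨h4, h3⟩
      · rintro ⟨h3, h4⟩; exact ⟨h4, h3, h4.trans hmu⟩
    rw [e1, e2, Real.volume_Icc, sub_zero, ← hFx₀]
    simp [hF]

lemma lintegral_measureReal_Iic (μ : Measure unitInterval) [IsFiniteMeasure μ]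
    [NullSingletonClass μ] {φ : ℝ → ENNReal} (hφ : Measurable φ) :
    ∫⁻ x, φ (μ.real (Set.Iic x)) ∂μ = ∫⁻ u in Set.Icc 0 (μ.real Set.univ), φ u := by
  rw [← map_measureReal_Iic, lintegral_map hφ (continuous_measureReal_Iic μ).measurable]

lemma setLIntegral_measureReal_Iic (μ : Measure unitInterval) [IsFiniteMeasure μ]
    [NullSingletonClass μ] {φ : ℝ → ENNReal} (hφ : Measurable φ) (y : unitInterval) :
    ∫⁻ x in Set.Iic y, φ (μ.real (Set.Iic x)) ∂μ = ∫⁻ u in Set.Icc 0 (μ.real (Set.Iic y)), φ u := by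
  have h1 := lintegral_measureReal_Iic (μ.restrict (Set.Iic y)) hφ
  rw [measureReal_restrict_apply_univ] at h1
  rw [← h1]
  refine setLIntegral_congr_fun measurableSet_Iic fun x hx => ?_
  rw [measureReal_restrict_apply measurableSet_Iic, Set.inter_eq_left.2 (Set.Iic_subset_Iic.2 hx)]

lemma ae_measureReal_Iic_pos (μ : Measure unitInterval) [IsFiniteMeasure μ]
    [NullSingletonClass μ] : ∀ᵐ x ∂μ, 0 < μ.real (Set.Iic x) := by
  have h1 : ∀ᵐ u ∂(μ.map fun x => μ.real (Set.Iic x)), (0 : ℝ) < u := by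
    rw [map_measureReal_Iic, ae_restrict_iff' measurableSet_Icc]
    have : ∀ᵐ u : ℝ, u ≠ 0 := by rw [ae_iff]; simp
    filter_upwards [this] with u hu hu'
    exact lt_of_le_of_ne hu'.1 hu.symm
  exact ae_of_ae_map (continuous_measureReal_Iic μ).measurable.aemeasurable h1

/-- Lebesgue measure on the unit interval, expressed by interval integrals. -/
lemma setLIntegral_Iic_ofReal {f : ℝ → ℝ} (hf : IntegrableOn f (Set.Icc 0 1))
    (h0 : ∀ x ∈ Set.Icc (0 : ℝ) 1, 0 ≤ f x) (x : unitInterval) :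
    ∫⁻ s in Set.Iic x, ENNReal.ofReal (f s) = ENNReal.ofReal (∫ s in (0 : ℝ)..x, f s) := by
  have h1 : ∫⁻ s in Set.Iic x, ENNReal.ofReal (f s) =
      ∫⁻ s in Set.Icc 0 (x : ℝ), ENNReal.ofReal (f s) := by
    have h2 := setLIntegral_subtype (μ := (volume : Measure ℝ)) (s := unitInterval)
      measurableSet_Icc (Set.Iic x) (fun s => ENNReal.ofReal (f s))
    rw [unitInterval.volume_def, h2, Set.image_subtype_val_Icc_Iic]
  have hsub : Set.Icc 0 (x : ℝ) ⊆ Set.Icc 0 1 := Set.Icc_subset_Icc_right x.2.2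
  rw [h1, intervalIntegral.integral_of_le x.2.1, ← integral_Icc_eq_integral_Ioc,
    ofReal_integral_eq_lintegral_ofReal]
  · exact hf.mono_set hsub
  · rw [EventuallyLE, ae_restrict_iff' measurableSet_Icc]
    exact ae_of_all _ fun s hs => h0 s (hsub hs)

/-! ### The explicit solution -/

lemma expInt_one_pos (β : ℝ) : 0 < expInt β 1 := expInt_pos β one_pos

/-- The function `w = 1 - β E_β(s) E_β(t) / E_β(1)`, which is `e^{-βR_β}` wherever it is positive, in
particular on a neighbourhood of the unit square. -/
def expR (β s t : ℝ) : ℝ := 1 - β * (expInt β s * expInt β t / expInt β 1)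

lemma continuous_expR (β : ℝ) : Continuous fun p : ℝ × ℝ => expR β p.1 p.2 := by
  unfold expR
  have := continuous_expInt β
  fun_prop

lemma expR_comm (β s t : ℝ) : expR β s t = expR β t s := by
  unfold expR; ring

lemma expR_pos (β : ℝ) {x y : ℝ} (hx : x ∈ Set.Icc (0 : ℝ) 1) (hy : y ∈ Set.Icc (0 : ℝ) 1) :
    0 < expR β x y := by
  have h1 := expInt_one_pos β
  have hx0 := expInt_nonneg β hx.1
  have hy0 := expInt_nonneg β hy.1
  have hq0 : 0 ≤ expInt β x * expInt β y / expInt β 1 := by positivity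
  have hq1 : expInt β x * expInt β y / expInt β 1 ≤ expInt β 1 := by
    rw [div_le_iff₀ h1]
    exact mul_le_mul ((strictMono_expInt β).monotone hx.2) ((strictMono_expInt β).monotone hy.2)
      hy0 h1.le
  unfold expR
  rcases le_total β 0 with hβ | hβ
  · nlinarith
  · have h2 := mul_expInt β 1
    have h3 := Real.exp_pos (-β * 1)
    nlinarith [mul_le_mul_of_nonneg_left hq1 hβ]

lemma expInt_zero_left (t : ℝ) : expInt 0 t = t := by simp [expInt]

lemma R_eq (β : ℝ) (hβ : β ≠ 0) (s t : ℝ) : R β s t = -(1 / β) * Real.log (expR β s t) := by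
  have h1 := (expInt_one_pos β).ne'
  rw [R, if_neg hβ, expR, ← mul_expInt, ← mul_expInt]
  have h2 := mul_expInt β 1
  rw [mul_one] at h2
  rw [← h2]
  congr 3
  field_simp

lemma R_comm (β s t : ℝ) : R β s t = R β t s := by
  unfold R; split_ifs <;> ring_nf

lemma exp_neg_R (β : ℝ) {s t : ℝ} (hw : 0 < expR β s t) :
    Real.exp (-β * R β s t) = expR β s t := by
  by_cases hβ : β = 0
  · simp [hβ, expR]
  · rw [R_eq β hβ]
    have : -β * (-(1 / β) * Real.log (expR β s t)) = Real.log (expR β s t) := by field_simp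
    rw [this, Real.exp_log hw]

lemma exp_R (β : ℝ) {s t : ℝ} (hw : 0 < expR β s t) :
    Real.exp (β * R β s t) = (expR β s t)⁻¹ := by
  rw [← exp_neg_R β hw, ← Real.exp_neg]; congr 1; ring

/-- In the variable `E_β` the function `R_β` is a product. -/
lemma expInt_R (β : ℝ) {s t : ℝ} (hw : 0 < expR β s t) :
    expInt β (R β s t) = expInt β s * expInt β t / expInt β 1 := by
  by_cases hβ : β = 0
  · subst hβ
    simp [expInt_zero_left, R]
  · have h1 := mul_expInt β (R β s t)
    rw [exp_neg_R β hw, expR] at h1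
    refine mul_left_cancel₀ hβ ?_
    linarith

lemma hasDerivAt_R (β : ℝ) {s t : ℝ} (hw : 0 < expR β s t) :
    HasDerivAt (fun t => R β s t)
      (expInt β s * Real.exp (-β * t) * Real.exp (β * R β s t) / expInt β 1) t := by
  by_cases hβ : β = 0
  · subst hβ
    have : (fun t => R 0 s t) = fun t => s * t := by ext t; simp [R]
    rw [this]
    simpa [expInt_zero_left] using (hasDerivAt_id t).const_mul s
  · have h1 : (fun t => R β s t) = fun t => -(1 / β) * Real.log (expR β s t) := by
      ext t; exact R_eq β hβ s t
    have h2 : HasDerivAt (fun t => expR β s t)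
        (-(β * (expInt β s * Real.exp (-β * t) / expInt β 1))) t := by
      unfold expR
      exact ((((hasDerivAt_expInt β t).const_mul _).div_const _).const_mul β).const_sub 1
    rw [exp_R β hw, h1]
    refine ((h2.log hw.ne').const_mul _).congr_deriv ?_
    have h3 := (expInt_one_pos β).ne'
    field_simp

lemma hasDerivAt_R_left (β : ℝ) {s t : ℝ} (hw : 0 < expR β s t) :
    HasDerivAt (fun s => R β s t)
      (expInt β t * Real.exp (-β * s) * Real.exp (β * R β s t) / expInt β 1) s := by
  rw [expR_comm] at hw
  have := hasDerivAt_R β hw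
  rw [R_comm β s t]
  exact this.congr_of_eventuallyEq (Eventually.of_forall fun s => R_comm β s t)

/-- The partial derivative `∂R_β/∂y`. -/
def derivR (β s t : ℝ) : ℝ :=
  expInt β s * Real.exp (-β * t) * Real.exp (β * R β s t) / expInt β 1

/-- The closed form `e^{β(2R_β - x - y)} / E_β(1)` of the density. -/
def densityFormula (β s t : ℝ) : ℝ := Real.exp (β * (2 * R β s t - s - t)) / expInt β 1

lemma hasDerivAt_derivR (β : ℝ) {s t : ℝ} (hw : 0 < expR β s t) :
    HasDerivAt (fun s => derivR β s t) (densityFormula β s t) s := by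
  unfold derivR
  have h1 := ((hasDerivAt_R_left β hw).const_mul β).exp
  have h2 := ((((hasDerivAt_expInt β s).mul_const (Real.exp (-β * t))).mul h1).div_const
    (expInt β 1))
  refine h2.congr_deriv ?_
  have hE := (expInt_one_pos β).ne'
  have e1 : densityFormula β s t = Real.exp (-β * s) * Real.exp (-β * t) *
      Real.exp (β * R β s t) * Real.exp (β * R β s t) / expInt β 1 := by
    rw [densityFormula, ← Real.exp_add, ← Real.exp_add, ← Real.exp_add]
    congr 2; ring
  have e2 : β * (expInt β s * expInt β t / expInt β 1) * Real.exp (β * R β s t) =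
      Real.exp (β * R β s t) - 1 := by
    rw [exp_R β hw]
    field_simp
    unfold expR
    field_simp
    ring
  rw [e1]
  field_simp at e2 ⊢
  linear_combination e2

lemma eventually_expR_pos (β : ℝ) {x y : ℝ} (hx : x ∈ Set.Icc (0 : ℝ) 1)
    (hy : y ∈ Set.Icc (0 : ℝ) 1) : ∀ᶠ s in 𝓝 x, 0 < expR β s y := by
  have hc : Continuous fun s => expR β s y :=
    (continuous_expR β).comp (by fun_prop : Continuous fun s : ℝ => (s, y))
  exact hc.continuousAt.eventually (lt_mem_nhds (expR_pos β hx hy))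

lemma deriv_R_eventuallyEq (β : ℝ) {x y : ℝ} (hx : x ∈ Set.Icc (0 : ℝ) 1)
    (hy : y ∈ Set.Icc (0 : ℝ) 1) :
    (fun s => deriv (fun t => R β s t) y) =ᶠ[𝓝 x] fun s => derivR β s y := by
  filter_upwards [eventually_expR_pos β hx hy] with s hs
  exact (hasDerivAt_R β hs).deriv

lemma hasDerivAt_deriv_R (β : ℝ) {x y : ℝ} (hx : x ∈ Set.Icc (0 : ℝ) 1)
    (hy : y ∈ Set.Icc (0 : ℝ) 1) :
    HasDerivAt (fun s => deriv (fun t => R β s t) y) (densityFormula β x y) x :=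
  (hasDerivAt_derivR β (expR_pos β hx hy)).congr_of_eventuallyEq (deriv_R_eventuallyEq β hx hy)

lemma density_eq (β : ℝ) {x y : ℝ} (hx : x ∈ Set.Icc (0 : ℝ) 1) (hy : y ∈ Set.Icc (0 : ℝ) 1) :
    density β x y = densityFormula β x y := (hasDerivAt_deriv_R β hx hy).deriv

lemma densityFormula_pos (β s t : ℝ) : 0 < densityFormula β s t :=
  div_pos (Real.exp_pos _) (expInt_one_pos β)

lemma continuousOn_R (β : ℝ) :
    ContinuousOn (fun p : ℝ × ℝ => R β p.1 p.2) (Set.Icc 0 1 ×ˢ Set.Icc 0 1) := by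
  by_cases hβ : β = 0
  · subst hβ
    simp only [R, if_true]
    fun_prop
  · simp only [R_eq β hβ]
    exact continuousOn_const.mul ((continuous_expR β).continuousOn.log
      fun p hp => (expR_pos β hp.1 hp.2).ne')

lemma continuousOn_densityFormula (β : ℝ) :
    ContinuousOn (fun p : ℝ × ℝ => densityFormula β p.1 p.2) (Set.Icc 0 1 ×ˢ Set.Icc 0 1) := by
  unfold densityFormula
  have := continuousOn_R β
  exact (Real.continuous_exp.comp_continuousOn (by fun_prop)).div_const _

lemma continuousOn_derivR (β : ℝ) :
    ContinuousOn (fun p : ℝ × ℝ => derivR β p.1 p.2) (Set.Icc 0 1 ×ˢ Set.Icc 0 1) := by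
  unfold derivR
  have := continuousOn_R β
  have h2 := continuous_expInt β
  exact ((by fun_prop : ContinuousOn (fun p : ℝ × ℝ => expInt β p.1 * Real.exp (-β * p.2)) _).mul
    (Real.continuous_exp.comp_continuousOn (by fun_prop))).div_const _

lemma R_zero_right (β : ℝ) {x : ℝ} (hx : x ∈ Set.Icc (0 : ℝ) 1) : R β x 0 = 0 := by
  have := expInt_R β (expR_pos β hx (Set.left_mem_Icc.2 zero_le_one))
  rw [expInt_zero, mul_zero, zero_div] at this
  exact (strictMono_expInt β).injective (this.trans (expInt_zero β).symm)

lemma R_one_right (β : ℝ) {x : ℝ} (hx : x ∈ Set.Icc (0 : ℝ) 1) : R β x 1 = x := by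
  have := expInt_R β (expR_pos β hx (Set.right_mem_Icc.2 zero_le_one))
  rw [mul_div_assoc, div_self (expInt_one_pos β).ne', mul_one] at this
  exact (strictMono_expInt β).injective this

lemma derivR_one_left (β : ℝ) {y : ℝ} (hy : y ∈ Set.Icc (0 : ℝ) 1) : derivR β 1 y = 1 := by
  rw [derivR, R_comm, R_one_right β hy, mul_assoc, ← Real.exp_add]
  simp [(expInt_one_pos β).ne']

lemma derivR_nonneg (β : ℝ) {s : ℝ} (hs : 0 ≤ s) (t : ℝ) : 0 ≤ derivR β s t :=
  div_nonneg (mul_nonneg (mul_nonneg (expInt_nonneg β hs) (Real.exp_pos _).le)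
    (Real.exp_pos _).le) (expInt_one_pos β).le

lemma uIcc_subset_Icc {x : ℝ} (hx : x ∈ Set.Icc (0 : ℝ) 1) : Set.uIcc 0 x ⊆ Set.Icc 0 1 := by
  rw [Set.uIcc_of_le hx.1]; exact Set.Icc_subset_Icc_right hx.2

lemma continuousOn_left {f : ℝ × ℝ → ℝ} (hf : ContinuousOn f (Set.Icc 0 1 ×ˢ Set.Icc 0 1)) {y : ℝ}
    (hy : y ∈ Set.Icc (0 : ℝ) 1) : ContinuousOn (fun s => f (s, y)) (Set.Icc 0 1) :=
  hf.comp (by fun_prop : ContinuousOn (fun s : ℝ => (s, y)) _) fun _ hs => ⟨hs, hy⟩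

lemma continuousOn_right {f : ℝ × ℝ → ℝ} (hf : ContinuousOn f (Set.Icc 0 1 ×ˢ Set.Icc 0 1)) {x : ℝ}
    (hx : x ∈ Set.Icc (0 : ℝ) 1) : ContinuousOn (fun t => f (x, t)) (Set.Icc 0 1) :=
  hf.comp (by fun_prop : ContinuousOn (fun t : ℝ => (x, t)) _) fun _ ht => ⟨hx, ht⟩

lemma integral_densityFormula (β : ℝ) {x y : ℝ} (hx : x ∈ Set.Icc (0 : ℝ) 1)
    (hy : y ∈ Set.Icc (0 : ℝ) 1) : ∫ s in (0 : ℝ)..x, densityFormula β s y = derivR β x y := by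
  rw [intervalIntegral.integral_eq_sub_of_hasDerivAt
    (fun s hs => hasDerivAt_derivR β (expR_pos β (uIcc_subset_Icc hx hs) hy))
    (((continuousOn_left (continuousOn_densityFormula β) hy).mono
      (uIcc_subset_Icc hx)).intervalIntegrable)]
  simp [derivR]

lemma integral_derivR (β : ℝ) {x y : ℝ} (hx : x ∈ Set.Icc (0 : ℝ) 1)
    (hy : y ∈ Set.Icc (0 : ℝ) 1) : ∫ t in (0 : ℝ)..y, derivR β x t = R β x y := by
  rw [intervalIntegral.integral_eq_sub_of_hasDerivAt (f' := derivR β x)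
    (fun t ht => hasDerivAt_R β (expR_pos β hx (uIcc_subset_Icc hy ht)))
    (((continuousOn_right (continuousOn_derivR β) hx).mono
      (uIcc_subset_Icc hy)).intervalIntegrable), R_zero_right β hx, sub_zero]

lemma densityFormula_eq (β : ℝ) {x : ℝ} (hx : 0 < x) (y : ℝ) :
    densityFormula β x y =
      derivR β x y * (Real.exp (-β * (x - R β x y)) / expInt β x) := by
  have h1 := (expInt_pos β hx).ne'
  have h2 := (expInt_one_pos β).ne'
  rw [densityFormula, derivR]
  have e : Real.exp (β * (2 * R β x y - x - y)) =
      Real.exp (-β * y) * Real.exp (β * R β x y) * Real.exp (-β * (x - R β x y)) := by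
    rw [← Real.exp_add, ← Real.exp_add]; congr 1; ring
  rw [e]
  field_simp

/-! ### Partial masses of a density on the square -/

/-- The mass `g(x, y) = ∫₀ˣ ρ(s, y) ds` to the left of `x` on the horizontal line at height `y`. -/
def partialMass (ρ : Square → ℝ≥0∞) (x y : unitInterval) : ℝ≥0∞ := ∫⁻ s in Set.Iic x, ρ (s, y)

/-- The measure `ρ(s, y) ds` on the horizontal line at height `y`. -/
def lineMeasure (ρ : Square → ℝ≥0∞) (y : unitInterval) : Measure unitInterval :=
  volume.withDensity fun s => ρ (s, y)

/-- The second marginal of the restriction of `ρ` to the strip `[0, x] × [0, 1]`. -/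
def stripMeasure (ρ : Square → ℝ≥0∞) (x : unitInterval) : Measure unitInterval :=
  volume.withDensity fun t => partialMass ρ x t

/-- The first marginal of `ρ`. -/
def fstMarginal (ρ : Square → ℝ≥0∞) : Measure unitInterval :=
  volume.withDensity fun s => ∫⁻ t, ρ (s, t)

/-- The first marginal distribution function `T(x) = ν([0, x] × [0, 1])`. -/
def stripMass (ρ : Square → ℝ≥0∞) (x : unitInterval) : ℝ := (stripMeasure ρ x).real Set.univ

/-- The joint distribution function `G(x, y) = ν([0, x] × [0, y])`. -/
def jointCdf (ρ : Square → ℝ≥0∞) (x y : unitInterval) : ℝ := (stripMeasure ρ x).real (Set.Iic y)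

instance (ρ : Square → ℝ≥0∞) (y : unitInterval) : NullSingletonClass (lineMeasure ρ y) :=
  ⟨fun _ => (withDensity_absolutelyContinuous _ _) (measure_singleton _)⟩

instance (ρ : Square → ℝ≥0∞) (x : unitInterval) : NullSingletonClass (stripMeasure ρ x) :=
  ⟨fun _ => (withDensity_absolutelyContinuous _ _) (measure_singleton _)⟩

instance (ρ : Square → ℝ≥0∞) : NullSingletonClass (fstMarginal ρ) :=
  ⟨fun _ => (withDensity_absolutelyContinuous _ _) (measure_singleton _)⟩

section Density

variable {ρ : Square → ℝ≥0∞}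

lemma measurable_partialMass (hρ : Measurable ρ) :
    Measurable fun z : Square => partialMass ρ z.1 z.2 := by
  have h1 (z : Square) : partialMass ρ z.1 z.2 =
      ∫⁻ s, {q : Square × unitInterval | q.2 ≤ q.1.1}.indicator
        (fun q => ρ (q.2, q.1.2)) (z, s) := by
    rw [partialMass, ← lintegral_indicator measurableSet_Iic]
    rfl
  simp only [h1]
  refine Measurable.lintegral_prod_right' ?_
  exact (hρ.comp (by fun_prop)).indicator
    (measurableSet_le measurable_snd measurable_fst.fst)

lemma measurable_jointCdf (hρ : Measurable ρ) :
    Measurable fun z : Square => jointCdf ρ z.1 z.2 := by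
  have h1 (z : Square) : jointCdf ρ z.1 z.2 =
      (∫⁻ t, {q : Square × unitInterval | q.2 ≤ q.1.2}.indicator
        (fun q => partialMass ρ q.1.1 q.2) (z, t)).toReal := by
    rw [jointCdf, measureReal_def, stripMeasure, withDensity_apply _ measurableSet_Iic,
      ← lintegral_indicator measurableSet_Iic]
    rfl
  simp only [h1]
  refine (Measurable.lintegral_prod_right' ?_).ennreal_toReal
  have h2 : Measurable fun q : Square × unitInterval => partialMass ρ q.1.1 q.2 :=
    (measurable_partialMass hρ).comp (by fun_prop : Measurable fun q : Square × unitInterval =>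
      (q.1.1, q.2))
  exact h2.indicator (measurableSet_le measurable_snd measurable_fst.snd)

lemma withDensity_prod_apply (hρ : Measurable ρ) {A B : Set unitInterval}
    (hA : MeasurableSet A) (hB : MeasurableSet B) :
    (volume : Measure Square).withDensity ρ (A ×ˢ B) = ∫⁻ s in A, ∫⁻ t in B, ρ (s, t) := by
  rw [withDensity_apply _ (hA.prod hB), Measure.volume_eq_prod, ← Measure.prod_restrict,
    lintegral_prod _ hρ.aemeasurable]

lemma withDensity_prod_apply_symm (hρ : Measurable ρ) {A B : Set unitInterval}
    (hA : MeasurableSet A) (hB : MeasurableSet B) :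
    (volume : Measure Square).withDensity ρ (A ×ˢ B) = ∫⁻ t in B, ∫⁻ s in A, ρ (s, t) := by
  rw [withDensity_apply _ (hA.prod hB), Measure.volume_eq_prod, ← Measure.prod_restrict,
    lintegral_prod_symm _ hρ.aemeasurable]

lemma stripMeasure_apply (hρ : Measurable ρ) (x : unitInterval) {B : Set unitInterval}
    (hB : MeasurableSet B) :
    stripMeasure ρ x B = (volume : Measure Square).withDensity ρ (Set.Iic x ×ˢ B) := by
  rw [stripMeasure, withDensity_apply _ hB, withDensity_prod_apply_symm hρ measurableSet_Iic hB]
  rfl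

lemma fstMarginal_apply (hρ : Measurable ρ) {A : Set unitInterval} (hA : MeasurableSet A) :
    fstMarginal ρ A = (volume : Measure Square).withDensity ρ (A ×ˢ Set.univ) := by
  rw [fstMarginal, withDensity_apply _ hA, withDensity_prod_apply hρ hA MeasurableSet.univ]
  simp

lemma fstMarginal_eq_map (hρ : Measurable ρ) :
    fstMarginal ρ = ((volume : Measure Square).withDensity ρ).map Prod.fst := by
  ext A hA
  rw [fstMarginal_apply hρ hA, Measure.map_apply measurable_fst hA, Set.prod_univ]

lemma lintegral_withDensity_eq_lines (hρ : Measurable ρ) {F : Square → ℝ≥0∞}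
    (hF : Measurable F) : ∫⁻ z, F z ∂((volume : Measure Square).withDensity ρ) =
      ∫⁻ y, ∫⁻ x, F (x, y) ∂(lineMeasure ρ y) := by
  rw [lintegral_withDensity_eq_lintegral_mul _ hρ hF, Measure.volume_eq_prod,
    lintegral_prod_symm _ (hρ.mul hF).aemeasurable]
  refine lintegral_congr fun y => ?_
  rw [lineMeasure, lintegral_withDensity_eq_lintegral_mul _ (f := fun s => ρ (s, y)) (g := fun s => F (s, y))
    (hρ.comp (by fun_prop : Measurable fun s : unitInterval => (s, y)))
    (hF.comp (by fun_prop : Measurable fun s : unitInterval => (s, y)))]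
  rfl

lemma lineMeasure_Iic (x y : unitInterval) : lineMeasure ρ y (Set.Iic x) = partialMass ρ x y := by
  rw [lineMeasure, withDensity_apply _ measurableSet_Iic, partialMass]

lemma lineMeasure_univ (y : unitInterval) : lineMeasure ρ y Set.univ = partialMass ρ 1 y := by
  rw [← lineMeasure_Iic]
  congr 1
  ext a; simp [unitInterval.le_one']

lemma Iic_one : Set.Iic (1 : unitInterval) = Set.univ := by
  ext a; simp [unitInterval.le_one']

lemma jointCdf_eq (hρ : Measurable ρ) (x y : unitInterval) : jointCdf ρ x y =
    ((volume : Measure Square).withDensity ρ).real (Set.Iic x ×ˢ Set.Iic y) := by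
  rw [jointCdf, measureReal_def, stripMeasure_apply hρ x measurableSet_Iic]; rfl

lemma stripMass_eq (hρ : Measurable ρ) (x : unitInterval) : stripMass ρ x =
    ((volume : Measure Square).withDensity ρ).real (Set.Iic x ×ˢ Set.univ) := by
  rw [stripMass, measureReal_def, stripMeasure_apply hρ x MeasurableSet.univ]; rfl

lemma stripMass_nonneg (x : unitInterval) : 0 ≤ stripMass ρ x := measureReal_nonneg

lemma jointCdf_nonneg (x y : unitInterval) : 0 ≤ jointCdf ρ x y := measureReal_nonneg

lemma jointCdf_one_right (x : unitInterval) : jointCdf ρ x 1 = stripMass ρ x := by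
  rw [jointCdf, stripMass, Iic_one]

lemma ae_ne_of_withDensity (ρ : Square → ℝ≥0∞) (a b : unitInterval) :
    ∀ᵐ w ∂((volume : Measure Square).withDensity ρ), w.1 ≠ a ∧ w.2 ≠ b := by
  refine (withDensity_absolutelyContinuous _ _).ae_le ?_
  have h1 : ∀ᵐ w : Square, w.1 ≠ a := by
    have : ∀ᵐ s : unitInterval, s ≠ a := by rw [ae_iff]; simp
    exact measurePreserving_fst.quasiMeasurePreserving.ae this
  have h2 : ∀ᵐ w : Square, w.2 ≠ b := by
    have : ∀ᵐ s : unitInterval, s ≠ b := by rw [ae_iff]; simp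
    exact measurePreserving_snd.quasiMeasurePreserving.ae this
  exact h1.and h2

lemma measurable_lineMass (hρ : Measurable ρ) : Measurable fun y => partialMass ρ 1 y :=
  (measurable_partialMass hρ).comp
    (by fun_prop : Measurable fun y : unitInterval => ((1 : unitInterval), y))

lemma stripMass_eq_fstMarginal (hρ : Measurable ρ) (x : unitInterval) :
    stripMass ρ x = (fstMarginal ρ).real (Set.Iic x) := by
  rw [stripMass_eq hρ, measureReal_def, measureReal_def, fstMarginal_apply hρ measurableSet_Iic]

section Prob

variable [IsProbabilityMeasure ((volume : Measure Square).withDensity ρ)]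

lemma isFiniteMeasure_stripMeasure (hρ : Measurable ρ) (x : unitInterval) :
    IsFiniteMeasure (stripMeasure ρ x) :=
  ⟨by rw [stripMeasure_apply hρ x MeasurableSet.univ]; exact measure_lt_top _ _⟩

lemma isProbabilityMeasure_fstMarginal (hρ : Measurable ρ) :
    IsProbabilityMeasure (fstMarginal ρ) :=
  ⟨by rw [fstMarginal_apply hρ MeasurableSet.univ, Set.univ_prod_univ, measure_univ]⟩

lemma lintegral_density (ρ : Square → ℝ≥0∞)
    [IsProbabilityMeasure ((volume : Measure Square).withDensity ρ)] : ∫⁻ z, ρ z = 1 := by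
  have h1 := measure_univ (μ := (volume : Measure Square).withDensity ρ)
  rwa [withDensity_apply _ MeasurableSet.univ, setLIntegral_univ] at h1

lemma lintegral_lineMass (hρ : Measurable ρ) : ∫⁻ y, partialMass ρ 1 y = 1 := by
  have h1 := lintegral_withDensity_eq_lines hρ (F := fun _ => 1) measurable_const
  simp only [lintegral_const, one_mul, measure_univ, lineMeasure_univ] at h1
  exact h1.symm

lemma ae_isFiniteMeasure_lineMeasure (hρ : Measurable ρ) :
    ∀ᵐ y, IsFiniteMeasure (lineMeasure ρ y) := by
  filter_upwards [ae_lt_top (measurable_lineMass hρ) (by rw [lintegral_lineMass hρ]; simp)]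
    with y hy
  exact ⟨by rwa [lineMeasure_univ]⟩

lemma jointCdf_le_stripMass (hρ : Measurable ρ) (x y : unitInterval) :
    jointCdf ρ x y ≤ stripMass ρ x := by
  rw [jointCdf_eq hρ, stripMass_eq hρ]
  exact measureReal_mono (Set.prod_mono_right (Set.subset_univ _))

lemma stripMass_le_one (hρ : Measurable ρ) (x : unitInterval) : stripMass ρ x ≤ 1 := by
  rw [stripMass_eq hρ]; exact measureReal_le_one

lemma continuous_stripMass (hρ : Measurable ρ) : Continuous (stripMass ρ) := by
  have := isProbabilityMeasure_fstMarginal hρ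
  have h1 : stripMass ρ = fun x => (fstMarginal ρ).real (Set.Iic x) :=
    funext (stripMass_eq_fstMarginal hρ)
  rw [h1]
  exact continuous_measureReal_Iic _

lemma continuous_jointCdf_left (hρ : Measurable ρ) (y : unitInterval) :
    Continuous fun x => jointCdf ρ x y := by
  set ν := (volume : Measure Square).withDensity ρ with hν
  let μ := (ν.restrict (Set.univ ×ˢ Set.Iic y)).map Prod.fst
  have hμ (A : Set unitInterval) (hA : MeasurableSet A) : μ A = ν (A ×ˢ Set.Iic y) := by
    rw [Measure.map_apply measurable_fst hA, Measure.restrict_apply (measurable_fst hA)]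
    congr 1
    ext z; simp
  have hs : NullSingletonClass μ := ⟨fun a => by
    rw [hμ _ (measurableSet_singleton a), hν, withDensity_prod_apply hρ
      (measurableSet_singleton a) measurableSet_Iic]
    simp⟩
  have h1 : (fun x => jointCdf ρ x y) = fun x => μ.real (Set.Iic x) := by
    ext x
    rw [jointCdf_eq hρ, measureReal_def, measureReal_def, hμ _ measurableSet_Iic]
  rw [h1]
  exact continuous_measureReal_Iic μ

/-! ### The energy -/

/-- The indicator that `w` lies to the upper left of `z`. -/
def upperLeft (z w : Square) : ℝ := if w.1 < z.1 ∧ z.2 < w.2 then 1 else 0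

lemma h_eq_upperLeft (z w : Square) : h z w = upperLeft z w + upperLeft w z := by
  unfold h upperLeft
  rw [Set.indicator_apply]
  have e : (((z.1 : ℝ) - w.1) * ((z.2 : ℝ) - w.2) ∈ Set.Iio (0 : ℝ)) ↔
      (w.1 < z.1 ∧ z.2 < w.2) ∨ (z.1 < w.1 ∧ w.2 < z.2) := by
    rw [Set.mem_Iio, mul_neg_iff, sub_pos, sub_neg, sub_neg, sub_pos]
    simp only [Subtype.coe_lt_coe]
  by_cases h1 : w.1 < z.1 ∧ z.2 < w.2
  · have h2 : ¬ (z.1 < w.1 ∧ w.2 < z.2) := fun h2 => lt_asymm h1.1 h2.1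
    simp [h1, h2, e]
  · by_cases h2 : z.1 < w.1 ∧ w.2 < z.2
    · simp [h1, h2, e]
    · rw [if_neg (by rw [e]; tauto), if_neg h1, if_neg h2, add_zero]

lemma measurable_upperLeft : Measurable fun q : Square × Square => upperLeft q.1 q.2 := by
  unfold upperLeft
  have h1 : MeasurableSet {q : Square × Square | q.2.1 < q.1.1} :=
    measurableSet_lt measurable_snd.fst measurable_fst.fst
  have h2 : MeasurableSet {q : Square × Square | q.1.2 < q.2.2} :=
    measurableSet_lt measurable_fst.snd measurable_snd.snd
  exact Measurable.ite (h1.inter h2) measurable_const measurable_const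

lemma integral_upperLeft (hρ : Measurable ρ) (z : Square) :
    ∫ w, upperLeft z w ∂((volume : Measure Square).withDensity ρ) =
      stripMass ρ z.1 - jointCdf ρ z.1 z.2 := by
  set ν := (volume : Measure Square).withDensity ρ with hν
  have h1 : ν.real ((Set.Iic z.1 ×ˢ Set.univ) \ (Set.Iic z.1 ×ˢ Set.Iic z.2)) =
      stripMass ρ z.1 - jointCdf ρ z.1 z.2 := by
    rw [measureReal_sdiff (Set.prod_mono_right (Set.subset_univ _))
      (measurableSet_Iic.prod measurableSet_Iic), stripMass_eq hρ, jointCdf_eq hρ]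
  rw [← h1, ← integral_indicator_one
    ((measurableSet_Iic.prod MeasurableSet.univ).diff (measurableSet_Iic.prod measurableSet_Iic))]
  refine integral_congr_ae ?_
  filter_upwards [ae_ne_of_withDensity ρ z.1 z.2] with w hw
  unfold upperLeft
  rw [Set.indicator_apply]
  refine if_congr ?_ rfl rfl
  simp only [Set.mem_sdiff, Set.mem_prod, Set.mem_Iic, Set.mem_univ, and_true, not_and, not_le]
  constructor
  · rintro ⟨h2, h3⟩; exact ⟨h2.le, fun _ => h3⟩
  · rintro ⟨h2, h3⟩; exact ⟨lt_of_le_of_ne h2 hw.1, h3 h2⟩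

/-- Each inverted pair is counted at its right-hand point. -/
lemma energy_eq (hρ : Measurable ρ) : energy ((volume : Measure Square).withDensity ρ) =
    ∫ z, (stripMass ρ z.1 - jointCdf ρ z.1 z.2) ∂((volume : Measure Square).withDensity ρ) := by
  set ν := (volume : Measure Square).withDensity ρ with hν
  have hb : Integrable (fun q : Square × Square => upperLeft q.1 q.2) (ν.prod ν) := by
    refine Integrable.of_bound (C := 1) measurable_upperLeft.aestronglyMeasurable
      (ae_of_all _ fun q => ?_)
    unfold upperLeft; split_ifs <;> simp
  have hb' : Integrable (fun q : Square × Square => upperLeft q.2 q.1) (ν.prod ν) := hb.swap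
  unfold energy
  have h1 : ∫ z, ∫ w, h z w ∂ν ∂ν = ∫ q, (upperLeft q.1 q.2 + upperLeft q.2 q.1) ∂(ν.prod ν) := by
    simp only [h_eq_upperLeft]
    exact (integral_prod _ (hb.add hb')).symm
  have h2 : ∫ q : Square × Square, upperLeft q.2 q.1 ∂(ν.prod ν) =
      ∫ q : Square × Square, upperLeft q.1 q.2 ∂(ν.prod ν) :=
    integral_prod_swap (fun q : Square × Square => upperLeft q.1 q.2)
  rw [h1, integral_add hb hb', h2, integral_prod _ hb]
  simp only [hν, integral_upperLeft hρ]
  ring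

end Prob

end Density

/-! ### The reference density -/

/-- The reference density `q(x, y) = min(g, 1) e^{-β(T - G)} / E_β(T)` attached to a density `ρ`.
Without the truncation, `q(x, ·)` is the law of a point whose height relative to the points on its
left is a truncated exponential variable. The truncation of `g` at `1` makes `log q` integrable
without any assumption on the second marginal. -/
def refDensity (β : ℝ) (ρ : Square → ℝ≥0∞) (z : Square) : ℝ :=
  min (partialMass ρ z.1 z.2).toReal 1 *
    (Real.exp (-β * (stripMass ρ z.1 - jointCdf ρ z.1 z.2)) / expInt β (stripMass ρ z.1))

lemma refDensity_nonneg (β : ℝ) (ρ : Square → ℝ≥0∞) (z : Square) : 0 ≤ refDensity β ρ z :=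
  mul_nonneg (le_min ENNReal.toReal_nonneg zero_le_one)
    (div_nonneg (Real.exp_pos _).le (expInt_nonneg β (stripMass_nonneg _)))

/-- The integral over `[0, m]` of the nonnegative function `-log (min u 1)`. -/
lemma setLIntegral_neg_log_min {m : ℝ} (hm : 0 ≤ m) :
    ∫⁻ u in Set.Icc 0 m, ENNReal.ofReal (-Real.log (min u 1)) =
      ENNReal.ofReal (min m 1 - min m 1 * Real.log (min m 1)) := by
  have hc0 : 0 ≤ min m 1 := le_min hm zero_le_one
  have h1 : ∫⁻ u in Set.Icc 0 m, ENNReal.ofReal (-Real.log (min u 1)) =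
      ∫⁻ u in Set.Icc 0 (min m 1), ENNReal.ofReal (-Real.log u) := by
    rw [← lintegral_indicator measurableSet_Icc, ← lintegral_indicator measurableSet_Icc]
    refine lintegral_congr fun u => ?_
    by_cases hu : u ∈ Set.Icc 0 (min m 1)
    · rw [Set.indicator_of_mem hu, Set.indicator_of_mem (show u ∈ Set.Icc 0 m from ⟨hu.1, hu.2.trans (min_le_left _ _)⟩),
        min_eq_left (hu.2.trans (min_le_right _ _))]
    · rw [Set.indicator_of_notMem hu]
      by_cases hu' : u ∈ Set.Icc 0 m
      · have : 1 ≤ u := by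
          by_contra hcon
          exact hu ⟨hu'.1, le_min hu'.2 (not_le.1 hcon).le⟩
        rw [Set.indicator_of_mem hu', min_eq_right this]; simp
      · rw [Set.indicator_of_notMem hu']
  rw [h1, ← ofReal_integral_eq_lintegral_ofReal]
  · rw [integral_Icc_eq_integral_Ioc, ← intervalIntegral.integral_of_le hc0,
      intervalIntegral.integral_neg, integral_log]
    congr 1; simp
  · have := (intervalIntegral.intervalIntegrable_log' (a := 0) (b := min m 1)).neg
    rw [intervalIntegrable_iff_integrableOn_Icc_of_le hc0] at this
    exact this
  · rw [EventuallyLE, ae_restrict_iff' measurableSet_Icc]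
    refine ae_of_all _ fun u hu => ?_
    exact neg_nonneg.2 (Real.log_nonpos hu.1 (hu.2.trans (min_le_right _ _)))

lemma setLIntegral_neg_log_min_le {m : ℝ} (hm : 0 ≤ m) :
    ∫⁻ u in Set.Icc 0 m, ENNReal.ofReal (-Real.log (min u 1)) ≤ 1 := by
  rw [setLIntegral_neg_log_min hm, ENNReal.ofReal_le_one]
  linarith [Real.self_sub_one_le_mul_log (le_min hm zero_le_one)]

lemma one_le_of_setLIntegral_neg_log_min {m : ℝ} (hm : 0 ≤ m)
    (h : ∫⁻ u in Set.Icc 0 m, ENNReal.ofReal (-Real.log (min u 1)) = 1) : 1 ≤ m := by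
  rw [setLIntegral_neg_log_min hm] at h
  by_contra! hlt
  rw [min_eq_left hlt.le, ENNReal.ofReal_eq_one] at h
  linarith [Real.self_sub_one_lt_mul_log hm hlt.ne]

section Prob

variable {ρ : Square → ℝ≥0∞} [IsProbabilityMeasure ((volume : Measure Square).withDensity ρ)]

lemma setLIntegral_exp_sub (β T : ℝ) {c m : ℝ} (hc : 0 ≤ c) (hm : 0 ≤ m) :
    ∫⁻ u in Set.Icc 0 m, ENNReal.ofReal (Real.exp (-β * (T - u)) / c) =
      ENNReal.ofReal (Real.exp (-β * T) * (expInt β m * Real.exp (β * m)) / c) := by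
  rw [← ofReal_integral_eq_lintegral_ofReal, integral_Icc_eq_integral_Ioc,
    ← intervalIntegral.integral_of_le hm, intervalIntegral.integral_div, integral_exp_sub]
  · have : Continuous fun u => Real.exp (-β * (T - u)) / c := by fun_prop
    exact this.integrableOn_Icc
  · exact ae_of_all _ fun u => div_nonneg (Real.exp_pos _).le hc

/-- Integration over `[0, y]` of a function of `G(x, ·)` against `g(x, t) dt`. -/
lemma setLIntegral_partialMass_comp (hρ : Measurable ρ) (x y : unitInterval) {φ : ℝ → ℝ≥0∞}
    (hφ : Measurable φ) : ∫⁻ t in Set.Iic y, partialMass ρ x t * φ (jointCdf ρ x t) =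
      ∫⁻ u in Set.Icc 0 (jointCdf ρ x y), φ u := by
  have := isFiniteMeasure_stripMeasure hρ x
  have h1 := setLIntegral_measureReal_Iic (stripMeasure ρ x) hφ y
  have hpm : Measurable fun t => partialMass ρ x t :=
    (measurable_partialMass hρ).comp (by fun_prop : Measurable fun t : unitInterval => (x, t))
  have hG : Measurable fun t => jointCdf ρ x t := by
    have hG' := (measurable_jointCdf hρ).comp (measurable_prodMk_left (x := x))
    exact hG'
  have h2 := setLIntegral_withDensity_eq_setLIntegral_mul volume hpm (hφ.comp hG)
    (measurableSet_Iic (a := y))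
  exact h2.symm.trans h1

/-- The untruncated reference density, integrated over `[0, y]` on a vertical line. -/
lemma setLIntegral_partialMass_mul (β : ℝ) (hρ : Measurable ρ) (x y : unitInterval) :
    ∫⁻ t in Set.Iic y, partialMass ρ x t * ENNReal.ofReal
      (Real.exp (-β * (stripMass ρ x - jointCdf ρ x t)) / expInt β (stripMass ρ x)) =
    ENNReal.ofReal (Real.exp (-β * stripMass ρ x) *
      (expInt β (jointCdf ρ x y) * Real.exp (β * jointCdf ρ x y)) / expInt β (stripMass ρ x)) := by
  rw [← setLIntegral_exp_sub β _ (expInt_nonneg β (stripMass_nonneg x)) (jointCdf_nonneg x y)]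
  exact setLIntegral_partialMass_comp hρ x y
    (φ := fun u => ENNReal.ofReal
      (Real.exp (-β * (stripMass ρ x - u)) / expInt β (stripMass ρ x))) (by fun_prop)

lemma lintegral_partialMass_mul_le (β : ℝ) (hρ : Measurable ρ) (x : unitInterval) :
    ∫⁻ t, partialMass ρ x t * ENNReal.ofReal
      (Real.exp (-β * (stripMass ρ x - jointCdf ρ x t)) / expInt β (stripMass ρ x)) ≤ 1 := by
  rcases (stripMass_nonneg (ρ := ρ) x).eq_or_lt with h0 | h0
  -- If `T(x) = 0`, the denominator `E_β(0)` is `0` and the integrand vanishes.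
  · simp [← h0]
  · have h1 := setLIntegral_partialMass_mul β hρ x 1
    rw [Iic_one, setLIntegral_univ, jointCdf_one_right] at h1
    rw [h1]
    have hE := (expInt_pos β h0).ne'
    have e : Real.exp (-β * stripMass ρ x) *
        (expInt β (stripMass ρ x) * Real.exp (β * stripMass ρ x)) / expInt β (stripMass ρ x) =
        Real.exp (-β * stripMass ρ x) * Real.exp (β * stripMass ρ x) := by
      field_simp
    rw [e, ← Real.exp_add]
    simp

lemma measurable_refDensity (β : ℝ) (hρ : Measurable ρ) : Measurable (refDensity β ρ) := by
  unfold refDensity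
  have h1 := measurable_partialMass hρ
  have h2 := measurable_jointCdf hρ
  have h3 := (continuous_stripMass hρ).measurable
  have h4 := (continuous_expInt β).measurable
  fun_prop

lemma ofReal_refDensity_le (β : ℝ) (ρ : Square → ℝ≥0∞) (z : Square) :
    ENNReal.ofReal (refDensity β ρ z) ≤ partialMass ρ z.1 z.2 * ENNReal.ofReal
      (Real.exp (-β * (stripMass ρ z.1 - jointCdf ρ z.1 z.2)) / expInt β (stripMass ρ z.1)) := by
  rw [refDensity, ENNReal.ofReal_mul (le_min ENNReal.toReal_nonneg zero_le_one)]
  gcongr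
  exact (ENNReal.ofReal_le_ofReal (min_le_left _ _)).trans ENNReal.ofReal_toReal_le

lemma lintegral_refDensity_le (β : ℝ) (hρ : Measurable ρ) :
    ∫⁻ z, ENNReal.ofReal (refDensity β ρ z) ≤ 1 := by
  rw [Measure.volume_eq_prod,
    lintegral_prod _ (measurable_refDensity β hρ).ennreal_ofReal.aemeasurable]
  calc _ ≤ ∫⁻ _ : unitInterval, 1 := lintegral_mono fun x =>
        (lintegral_mono fun t => ofReal_refDensity_le β ρ (x, t)).trans
          (lintegral_partialMass_mul_le β hρ x)
    _ = 1 := by simp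

lemma ae_stripMass_pos (hρ : Measurable ρ) :
    ∀ᵐ z ∂((volume : Measure Square).withDensity ρ), 0 < stripMass ρ z.1 := by
  have := isProbabilityMeasure_fstMarginal hρ
  have h1 := ae_measureReal_Iic_pos (fstMarginal ρ)
  simp only [← stripMass_eq_fstMarginal hρ] at h1
  rw [fstMarginal_eq_map hρ] at h1
  exact ae_of_ae_map measurable_fst.aemeasurable h1

lemma ae_partialMass_pos (hρ : Measurable ρ) :
    ∀ᵐ z ∂((volume : Measure Square).withDensity ρ), 0 < (partialMass ρ z.1 z.2).toReal := by
  have hm := (measurable_partialMass hρ).ennreal_toReal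
  have hS : MeasurableSet {z : Square | ¬ 0 < (partialMass ρ z.1 z.2).toReal} :=
    (measurableSet_lt measurable_const hm).compl
  rw [ae_iff, ← lintegral_indicator_one hS, lintegral_withDensity_eq_lines hρ
    (measurable_one.indicator hS)]
  refine (lintegral_eq_zero_of_ae_eq_zero ?_)
  filter_upwards [ae_isFiniteMeasure_lineMeasure hρ] with y hy
  refine lintegral_eq_zero_of_ae_eq_zero ?_
  filter_upwards [ae_measureReal_Iic_pos (lineMeasure ρ y)] with x hx
  rw [measureReal_def, lineMeasure_Iic] at hx
  simp [hx]

lemma ae_refDensity_pos (β : ℝ) (hρ : Measurable ρ) :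
    ∀ᵐ z ∂((volume : Measure Square).withDensity ρ), 0 < refDensity β ρ z := by
  filter_upwards [ae_stripMass_pos hρ, ae_partialMass_pos hρ] with z h1 h2
  exact mul_pos (lt_min h2 one_pos) (div_pos (Real.exp_pos _) (expInt_pos β h1))

/-- At height `y` the function `g(·, y)` pushes `ρ(s, y) ds` forward to Lebesgue measure on
`[0, g(1, y)]`. -/
lemma lintegral_neg_log_partialMass (hρ : Measurable ρ) :
    ∫⁻ z, ENNReal.ofReal (-Real.log (min (partialMass ρ z.1 z.2).toReal 1))
      ∂((volume : Measure Square).withDensity ρ) =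
    ∫⁻ y, ∫⁻ u in Set.Icc 0 (partialMass ρ 1 y).toReal, ENNReal.ofReal (-Real.log (min u 1)) := by
  have hm := (measurable_partialMass hρ).ennreal_toReal
  rw [lintegral_withDensity_eq_lines hρ (by fun_prop)]
  refine lintegral_congr_ae ?_
  filter_upwards [ae_isFiniteMeasure_lineMeasure hρ] with y hy
  have h1 := lintegral_measureReal_Iic (lineMeasure ρ y)
    (φ := fun u => ENNReal.ofReal (-Real.log (min u 1))) (by fun_prop)
  simp only [measureReal_def, lineMeasure_Iic, lineMeasure_univ] at h1
  exact h1

lemma lintegral_neg_log_partialMass_le (hρ : Measurable ρ) :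
    ∫⁻ z, ENNReal.ofReal (-Real.log (min (partialMass ρ z.1 z.2).toReal 1))
      ∂((volume : Measure Square).withDensity ρ) ≤ 1 := by
  rw [lintegral_neg_log_partialMass hρ]
  calc _ ≤ ∫⁻ _ : unitInterval, 1 := lintegral_mono fun y =>
        setLIntegral_neg_log_min_le ENNReal.toReal_nonneg
    _ = 1 := by simp

lemma neg_log_min_nonneg {u : ℝ} (hu : 0 ≤ u) : 0 ≤ -Real.log (min u 1) :=
  neg_nonneg.2 (Real.log_nonpos (le_min hu zero_le_one) (min_le_right _ _))

lemma integrable_log_min_partialMass (hρ : Measurable ρ) :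
    Integrable (fun z : Square => Real.log (min (partialMass ρ z.1 z.2).toReal 1))
      ((volume : Measure Square).withDensity ρ) := by
  have hm := (measurable_partialMass hρ).ennreal_toReal
  have h1 : Integrable (fun z : Square => -Real.log (min (partialMass ρ z.1 z.2).toReal 1))
      ((volume : Measure Square).withDensity ρ) := by
    refine ⟨(by fun_prop : Measurable _).aestronglyMeasurable, ?_⟩
    rw [hasFiniteIntegral_iff_ofReal (ae_of_all _ fun z => neg_log_min_nonneg ENNReal.toReal_nonneg)]
    exact (lintegral_neg_log_partialMass_le hρ).trans_lt ENNReal.one_lt_top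
  exact integrable_neg_iff.1 h1

lemma ofReal_neg_integral_log_min (hρ : Measurable ρ) :
    ENNReal.ofReal (-∫ z : Square, Real.log (min (partialMass ρ z.1 z.2).toReal 1)
      ∂((volume : Measure Square).withDensity ρ)) =
    ∫⁻ y, ∫⁻ u in Set.Icc 0 (partialMass ρ 1 y).toReal, ENNReal.ofReal (-Real.log (min u 1)) := by
  rw [← lintegral_neg_log_partialMass hρ, ← integral_neg]
  exact ofReal_integral_eq_lintegral_ofReal (integrable_log_min_partialMass hρ).neg
    (ae_of_all _ fun z => neg_log_min_nonneg ENNReal.toReal_nonneg)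

lemma neg_one_le_integral_log_min (hρ : Measurable ρ) :
    -1 ≤ ∫ z : Square, Real.log (min (partialMass ρ z.1 z.2).toReal 1)
      ∂((volume : Measure Square).withDensity ρ) := by
  have h1 := ofReal_neg_integral_log_min hρ
  rw [← lintegral_neg_log_partialMass hρ] at h1
  have h2 := lintegral_neg_log_partialMass_le hρ
  rw [← h1, ENNReal.ofReal_le_one] at h2
  linarith

lemma integrable_and_integral_log_expInt (β : ℝ) (hρ : Measurable ρ) :
    Integrable (fun z : Square => Real.log (expInt β (stripMass ρ z.1)))
        ((volume : Measure Square).withDensity ρ) ∧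
      ∫ z : Square, Real.log (expInt β (stripMass ρ z.1))
        ∂((volume : Measure Square).withDensity ρ) =
      ∫ t in (0 : ℝ)..1, Real.log (expInt β t) := by
  set ν := (volume : Measure Square).withDensity ρ with hν
  have := isProbabilityMeasure_fstMarginal hρ
  have hT := (continuous_stripMass hρ).measurable
  have h1 : ν.map (fun z => stripMass ρ z.1) = (volume : Measure ℝ).restrict (Set.Icc 0 1) := by
    have h2 := map_measureReal_Iic (fstMarginal ρ)
    simp only [← stripMass_eq_fstMarginal hρ] at h2
    rw [fstMarginal_eq_map hρ, Measure.map_map hT measurable_fst, ← fstMarginal_eq_map hρ] at h2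
    rw [probReal_univ] at h2
    exact h2
  have hm : Measurable fun t => Real.log (expInt β t) :=
    Real.measurable_log.comp (continuous_expInt β).measurable
  have hT' : Measurable fun z : Square => stripMass ρ z.1 := hT.comp measurable_fst
  have h3 : Integrable (fun t => Real.log (expInt β t)) (ν.map fun z => stripMass ρ z.1) := by
    rw [h1]
    exact (intervalIntegrable_iff_integrableOn_Icc_of_le zero_le_one).1
      (intervalIntegrable_log_expInt β)
  refine ⟨h3.comp_measurable hT', ?_⟩
  rw [← integral_map (f := fun t => Real.log (expInt β t)) hT'.aemeasurable
    hm.aestronglyMeasurable, h1, integral_Icc_eq_integral_Ioc,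
    intervalIntegral.integral_of_le zero_le_one]

lemma integrable_stripMass_sub (hρ : Measurable ρ) :
    Integrable (fun z : Square => stripMass ρ z.1 - jointCdf ρ z.1 z.2)
      ((volume : Measure Square).withDensity ρ) := by
  have hT := (continuous_stripMass hρ).measurable
  have hG := measurable_jointCdf hρ
  refine Integrable.of_bound (C := 1)
    ((hT.comp measurable_fst).sub hG).aestronglyMeasurable (ae_of_all _ fun z => ?_)
  rw [Real.norm_eq_abs, abs_of_nonneg (sub_nonneg.2 (jointCdf_le_stripMass hρ _ _))]
  linarith [stripMass_le_one hρ z.1, jointCdf_nonneg (ρ := ρ) z.1 z.2]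

/-- The logarithm of the reference density recovers the energy and the pressure. -/
lemma integrable_and_integral_log_refDensity (β : ℝ) (hρ : Measurable ρ) :
    Integrable (fun z => Real.log (refDensity β ρ z))
        ((volume : Measure Square).withDensity ρ) ∧
      ∫ z, Real.log (refDensity β ρ z) ∂((volume : Measure Square).withDensity ρ) =
      (∫ z : Square, Real.log (min (partialMass ρ z.1 z.2).toReal 1)
        ∂((volume : Measure Square).withDensity ρ)) -
      β * energy ((volume : Measure Square).withDensity ρ) - (pressure β - 1) := by
  have i1 := integrable_log_min_partialMass hρ
  have i2 := (integrable_stripMass_sub hρ).const_mul β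
  obtain ⟨i3, h3⟩ := integrable_and_integral_log_expInt β hρ
  have hae : (fun z : Square => Real.log (min (partialMass ρ z.1 z.2).toReal 1) -
      β * (stripMass ρ z.1 - jointCdf ρ z.1 z.2) - Real.log (expInt β (stripMass ρ z.1)))
      =ᵐ[(volume : Measure Square).withDensity ρ] fun z => Real.log (refDensity β ρ z) := by
    filter_upwards [ae_stripMass_pos hρ, ae_partialMass_pos hρ] with z hz1 hz2
    rw [refDensity, Real.log_mul (lt_min hz2 one_pos).ne'
      (div_pos (Real.exp_pos _) (expInt_pos β hz1)).ne',
      Real.log_div (Real.exp_pos _).ne' (expInt_pos β hz1).ne', Real.log_exp]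
    ring
  refine ⟨((i1.sub i2).sub i3).congr hae, ?_⟩
  rw [← integral_congr_ae hae]
  refine (integral_sub (i1.sub i2) i3).trans ?_
  rw [integral_sub' i1 i2, integral_const_mul, ← energy_eq hρ, h3, pressure_eq]
  ring

end Prob

/-! ### The Gibbs inequality -/

/-- Gibbs' inequality for a subprobability density `q`, with the case of equality. -/
lemma gibbs_inequality {α : Type*} [MeasurableSpace α] {μ : Measure α} {ρ : α → ℝ≥0∞}
    (hρ : Measurable ρ) [IsProbabilityMeasure (μ.withDensity ρ)] {q : α → ℝ} (hq : Measurable q)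
    (hq0 : ∀ z, 0 ≤ q z) (hq1 : ∫⁻ z, ENNReal.ofReal (q z) ∂μ ≤ 1)
    (hpos : ∀ᵐ z ∂(μ.withDensity ρ), 0 < q z)
    (i1 : Integrable (fun z => Real.log (ρ z).toReal) (μ.withDensity ρ))
    (i2 : Integrable (fun z => Real.log (q z)) (μ.withDensity ρ)) :
    ∫ z, Real.log (q z) ∂(μ.withDensity ρ) ≤ ∫ z, Real.log (ρ z).toReal ∂(μ.withDensity ρ) ∧
    (∫ z, Real.log (q z) ∂(μ.withDensity ρ) = ∫ z, Real.log (ρ z).toReal ∂(μ.withDensity ρ) →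
      (fun z => ENNReal.ofReal (q z)) =ᵐ[μ] ρ) := by
  set ν := μ.withDensity ρ with hν
  have hmass : ∫⁻ z, ρ z ∂μ = 1 := by
    have := measure_univ (μ := ν)
    rwa [hν, withDensity_apply _ MeasurableSet.univ, setLIntegral_univ] at this
  have hfin : ∀ᵐ z ∂ν, ρ z ≠ ∞ :=
    (withDensity_absolutelyContinuous μ ρ).ae_le (ae_lt_top hρ (by simp [hmass])
      |>.mono fun _ h => h.ne)
  have hne : ∀ᵐ z ∂ν, ρ z ≠ 0 := by
    rw [hν, ae_withDensity_iff hρ]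
    exact ae_of_all _ fun _ h => h
  have hρpos : ∀ᵐ z ∂ν, 0 < (ρ z).toReal := by
    filter_upwards [hfin, hne] with z h1 h2
    exact ENNReal.toReal_pos h2 h1
  set r : α → ℝ := fun z => q z / (ρ z).toReal with hr
  have hrm : Measurable r := hq.div hρ.ennreal_toReal
  have hr0 (z : α) : 0 ≤ r z := div_nonneg (hq0 z) ENNReal.toReal_nonneg
  have hrle : ∫⁻ z, ENNReal.ofReal (r z) ∂ν ≤ 1 := by
    rw [hν, lintegral_withDensity_eq_lintegral_mul _ hρ hrm.ennreal_ofReal]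
    refine (lintegral_mono_ae ?_).trans hq1
    filter_upwards [ae_lt_top hρ (by simp [hmass])] with z hz
    rcases eq_or_ne (ρ z) 0 with h0 | h0
    · simp [h0]
    · have hpz := ENNReal.toReal_pos h0 hz.ne
      rw [Pi.mul_apply, hr, ENNReal.ofReal_div_of_pos hpz, ENNReal.ofReal_toReal hz.ne,
        ENNReal.mul_div_cancel h0 hz.ne]
  have ir : Integrable r ν := by
    refine ⟨hrm.aestronglyMeasurable, ?_⟩
    rw [hasFiniteIntegral_iff_ofReal (ae_of_all _ hr0)]
    exact hrle.trans_lt ENNReal.one_lt_top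
  have hr1 : ∫ z, r z ∂ν ≤ 1 := by
    have := ofReal_integral_eq_lintegral_ofReal ir (ae_of_all _ hr0)
    rw [← this, ENNReal.ofReal_le_one] at hrle
    exact hrle
  set k : α → ℝ := fun z => r z - 1 - (Real.log (q z) - Real.log (ρ z).toReal) with hk
  have ik : Integrable k ν := (ir.sub (integrable_const 1)).sub (i2.sub i1)
  have hk_eq : ∀ᵐ z ∂ν, 0 < r z ∧ k z = r z - 1 - Real.log (r z) := by
    filter_upwards [hpos, hρpos] with z h1 h2
    refine ⟨div_pos h1 h2, ?_⟩
    rw [hk, hr, Real.log_div h1.ne' h2.ne']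
  have hk0 : 0 ≤ᵐ[ν] k := by
    filter_upwards [hk_eq] with z hz
    rw [hz.2]
    have := Real.log_le_sub_one_of_pos hz.1
    simp only [Pi.zero_apply]; linarith
  have hkint : ∫ z, k z ∂ν =
      (∫ z, r z ∂ν) - 1 - ((∫ z, Real.log (q z) ∂ν) - ∫ z, Real.log (ρ z).toReal ∂ν) := by
    refine (integral_sub (ir.sub (integrable_const 1)) (i2.sub i1)).trans ?_
    rw [integral_sub' ir (integrable_const 1), integral_sub' i2 i1]
    simp
  have hknn := integral_nonneg_of_ae hk0
  refine ⟨by linarith, fun heq => ?_⟩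
  have hkz : ∫ z, k z ∂ν = 0 := le_antisymm (by linarith) hknn
  rw [integral_eq_zero_iff_of_nonneg_ae hk0 ik] at hkz
  have hr_one : ∀ᵐ z ∂ν, ENNReal.ofReal (q z) = ρ z := by
    filter_upwards [hkz, hk_eq, hfin, hρpos] with z h1 h2 h3 h4
    have h5 : r z = 1 := by
      by_contra hne
      have := Real.log_lt_sub_one_of_pos h2.1 hne
      have h6 : k z = 0 := h1
      linarith [h2.2]
    have h7 : q z = (ρ z).toReal := by
      rw [hr] at h5
      exact (div_eq_one_iff_eq h4.ne').1 h5
    rw [h7, ENNReal.ofReal_toReal h3]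
  have hle : ρ ≤ᵐ[μ] fun z => ENNReal.ofReal (q z) := by
    rw [hν, ae_withDensity_iff hρ] at hr_one
    filter_upwards [hr_one] with z hz
    rcases eq_or_ne (ρ z) 0 with h0 | h0
    · rw [h0]; exact bot_le
    · exact (hz h0).ge
  exact (ae_eq_of_ae_le_of_lintegral_le hle (by simp [hmass]) hq.ennreal_ofReal.aemeasurable
    (hq1.trans hmass.ge)).symm

section Prob

variable {ρ : Square → ℝ≥0∞} [IsProbabilityMeasure ((volume : Measure Square).withDensity ρ)]

/-- A density of zero free energy coincides with its reference density and has a uniform second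
marginal. -/
lemma eq_refDensity_of_freeEnergy_eq_zero (β : ℝ) (hρ : Measurable ρ)
    (i1 : Integrable (fun z => Real.log (ρ z).toReal) ((volume : Measure Square).withDensity ρ))
    (h0 : ∫ z, Real.log (ρ z).toReal ∂((volume : Measure Square).withDensity ρ) +
      β * energy ((volume : Measure Square).withDensity ρ) + pressure β = 0) :
    (fun z => ENNReal.ofReal (refDensity β ρ z)) =ᵐ[volume] ρ ∧
      ∀ᵐ y, partialMass ρ 1 y = 1 := by
  obtain ⟨i2, h2⟩ := integrable_and_integral_log_refDensity β hρ
  obtain ⟨h3, h4⟩ := gibbs_inequality hρ (measurable_refDensity β hρ) (refDensity_nonneg β ρ)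
    (lintegral_refDensity_le β hρ) (ae_refDensity_pos β hρ) i1 i2
  have h5 := neg_one_le_integral_log_min hρ
  refine ⟨h4 (by linarith), ?_⟩
  have h6 : ∫ z : Square, Real.log (min (partialMass ρ z.1 z.2).toReal 1)
      ∂((volume : Measure Square).withDensity ρ) = -1 := by linarith
  have h7 := ofReal_neg_integral_log_min hρ
  rw [h6, neg_neg, ENNReal.ofReal_one] at h7
  have h8 : (fun y => ∫⁻ u in Set.Icc 0 (partialMass ρ 1 y).toReal,
      ENNReal.ofReal (-Real.log (min u 1))) =ᵐ[volume] fun _ => 1 := by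
    refine ae_eq_of_ae_le_of_lintegral_le
      (ae_of_all _ fun y => setLIntegral_neg_log_min_le ENNReal.toReal_nonneg) (by simp [← h7])
      aemeasurable_const (by simp [← h7])
  have h9 : (fun _ => 1) ≤ᵐ[volume] fun y => partialMass ρ 1 y := by
    filter_upwards [h8] with y hy
    have := one_le_of_setLIntegral_neg_log_min ENNReal.toReal_nonneg hy
    rw [← ENNReal.ofReal_one]
    exact (ENNReal.ofReal_le_ofReal this).trans ENNReal.ofReal_toReal_le
  exact (ae_eq_of_ae_le_of_lintegral_le h9 (by simp) (measurable_lineMass hρ).aemeasurable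
    (by simp [lintegral_lineMass hρ])).symm

lemma freeEnergy_eq_zero_of_eq_refDensity (β : ℝ) (hρ : Measurable ρ)
    (h1 : (fun z => Real.log (ρ z).toReal) =ᵐ[(volume : Measure Square).withDensity ρ]
      fun z => Real.log (refDensity β ρ z)) (h2 : ∀ᵐ y, partialMass ρ 1 y = 1) :
    ∫ z, Real.log (ρ z).toReal ∂((volume : Measure Square).withDensity ρ) +
      β * energy ((volume : Measure Square).withDensity ρ) + pressure β = 0 := by
  have h3 := (integrable_and_integral_log_refDensity β hρ).2
  have h4 := ofReal_neg_integral_log_min hρ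
  have h5 : ∫⁻ y, ∫⁻ u in Set.Icc 0 (partialMass ρ 1 y).toReal,
      ENNReal.ofReal (-Real.log (min u 1)) = 1 := by
    have : ∀ᵐ y, ∫⁻ u in Set.Icc 0 (partialMass ρ 1 y).toReal,
        ENNReal.ofReal (-Real.log (min u 1)) = 1 := by
      filter_upwards [h2] with y hy
      rw [hy, setLIntegral_neg_log_min ENNReal.toReal_nonneg]; simp
    rw [lintegral_congr_ae this]; simp
  rw [h5, ENNReal.ofReal_eq_one] at h4
  rw [integral_congr_ae h1]
  linarith

/-! ### The equation for the distribution function -/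

/-- Differentiating `γ(x) = ∫₀ˣ e^{-βs} E_β(γ) e^{βγ} / E_β(s) ds` gives
`E_β(γ)' / E_β(γ) = E_β' / E_β`, so that `E_β(γ) / E_β` is constant. -/
lemma expInt_eq_mul_of_integral_eq (β : ℝ) {γ : ℝ → ℝ} (hγ : Continuous γ)
    (h0 : ∀ s, 0 ≤ s → 0 ≤ γ s) (hle : ∀ s ∈ Set.Icc (0 : ℝ) 1, γ s ≤ s)
    (hint : ∀ x : unitInterval, ENNReal.ofReal (γ x) = ∫⁻ s in Set.Iic x, ENNReal.ofReal
      (Real.exp (-β * s) * (expInt β (γ s) * Real.exp (β * γ s)) / expInt β s))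
    {x : ℝ} (hx : x ∈ Set.Ioc (0 : ℝ) 1) :
    expInt β (γ x) = expInt β x * expInt β (γ 1) / expInt β 1 := by
  set a : ℝ → ℝ := fun s =>
    Real.exp (-β * s) * (expInt β (γ s) * Real.exp (β * γ s)) / expInt β s with ha
  have hEc := continuous_expInt β
  have ham : Measurable a := by
    have := hEc.measurable
    have := hγ.measurable
    fun_prop
  have hac {s : ℝ} (hs : 0 < s) : ContinuousAt a s := by
    refine ContinuousAt.div ?_ hEc.continuousAt (expInt_pos β hs).ne'
    exact (by fun_prop : Continuous fun s : ℝ =>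
      Real.exp (-β * s) * (expInt β (γ s) * Real.exp (β * γ s))).continuousAt
  have ha0 (s : ℝ) (hs : s ∈ Set.Icc (0 : ℝ) 1) : 0 ≤ a s :=
    div_nonneg (mul_nonneg (Real.exp_pos _).le (mul_nonneg (expInt_nonneg β (h0 s hs.1))
      (Real.exp_pos _).le)) (expInt_nonneg β hs.1)
  have hbound (s : ℝ) (hs : s ∈ Set.Icc (0 : ℝ) 1) : a s ≤ Real.exp |β| * Real.exp |β| := by
    rcases hs.1.eq_or_lt with hs0 | hs0
    · have : a s = 0 := by simp [ha, ← hs0]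
      rw [this]; positivity
    have hE := expInt_pos β hs0
    have h1 : expInt β (γ s) / expInt β s ≤ 1 := by
      rw [div_le_one hE]
      exact (strictMono_expInt β).monotone (hle s hs)
    have hγ1 : γ s ≤ 1 := (hle s hs).trans hs.2
    have e1 : Real.exp (-β * s) ≤ Real.exp |β| := by
      rw [Real.exp_le_exp]
      nlinarith [neg_abs_le β, abs_nonneg β, hs.1, hs.2]
    have e2 : Real.exp (β * γ s) ≤ Real.exp |β| := by
      rw [Real.exp_le_exp]
      nlinarith [le_abs_self β, abs_nonneg β, h0 s hs.1]
    have e3 : a s = (Real.exp (-β * s) * Real.exp (β * γ s)) *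
        (expInt β (γ s) / expInt β s) := by rw [ha]; ring
    rw [e3]
    calc _ ≤ (Real.exp (-β * s) * Real.exp (β * γ s)) * 1 := by gcongr
      _ ≤ Real.exp |β| * Real.exp |β| := by rw [mul_one]; gcongr
  have hai : IntegrableOn a (Set.Icc 0 1) := by
    refine Integrable.of_bound (C := Real.exp |β| * Real.exp |β|) ham.aestronglyMeasurable ?_
    rw [ae_restrict_iff' measurableSet_Icc]
    refine ae_of_all _ fun s hs => ?_
    rw [Real.norm_eq_abs, abs_of_nonneg (ha0 s hs)]
    exact hbound s hs
  have hγeq (s : ℝ) (hs : s ∈ Set.Icc (0 : ℝ) 1) : γ s = ∫ u in (0 : ℝ)..s, a u := by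
    have h1 := hint ⟨s, hs⟩
    rw [setLIntegral_Iic_ofReal hai ha0] at h1
    exact (ENNReal.ofReal_eq_ofReal_iff (h0 s hs.1) (intervalIntegral.integral_nonneg hs.1
      fun u hu => ha0 u ⟨hu.1, hu.2.trans hs.2⟩)).1 h1
  have hderiv (s : ℝ) (hs : s ∈ Set.Ioo (0 : ℝ) 1) : HasDerivAt γ (a s) s := by
    have hii : IntervalIntegrable a volume 0 s := by
      rw [intervalIntegrable_iff_integrableOn_Icc_of_le hs.1.le]
      exact hai.mono_set (Set.Icc_subset_Icc_right hs.2.le)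
    have h1 := intervalIntegral.integral_hasDerivAt_right hii
      (ham.stronglyMeasurable.stronglyMeasurableAtFilter) (hac hs.1)
    refine h1.congr_of_eventuallyEq ?_
    filter_upwards [Ioo_mem_nhds hs.1 hs.2] with u hu
    exact hγeq u ⟨hu.1.le, hu.2.le⟩
  have hconst := constant_of_has_deriv_right_zero (f := fun s => expInt β (γ s) / expInt β s)
    (a := x) (b := 1) ?_ ?_ 1 (Set.right_mem_Icc.2 hx.2)
  · have hE := (expInt_pos β hx.1).ne'
    have hE1 := (expInt_one_pos β).ne'
    field_simp at hconst ⊢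
    linarith
  · exact ContinuousOn.div (by fun_prop) hEc.continuousOn
      fun s hs => (expInt_pos β (hx.1.trans_le hs.1)).ne'
  · intro s hs
    have hs0 : 0 < s := hx.1.trans_le hs.1
    have hE := (expInt_pos β hs0).ne'
    have h1 := (((hasDerivAt_expInt β (γ s)).comp s (hderiv s ⟨hs0, hs.2⟩)).div
      (hasDerivAt_expInt β s) hE)
    refine (h1.congr_deriv ?_).hasDerivWithinAt
    have e : Real.exp (-(β * γ s)) * Real.exp (β * γ s) = 1 := by rw [← Real.exp_add]; simp
    have e' : Real.exp (-β * γ s) * a s * expInt β s = expInt β (γ s) * Real.exp (-β * s) := by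
      rw [ha]
      field_simp
      linear_combination expInt β (γ s) * e
    simp only [Function.comp]
    rw [e', sub_self, zero_div]

/-- A density that equals its reference density and has a uniform second marginal has distribution
function `R_β`. -/
lemma jointCdf_eq_R (β : ℝ) (hρ : Measurable ρ)
    (h1 : (fun z => ENNReal.ofReal (refDensity β ρ z)) =ᵐ[volume] ρ)
    (h2 : ∀ᵐ y, partialMass ρ 1 y = 1) (x y : unitInterval) :
    jointCdf ρ x y = R β x y := by
  -- The mass on each horizontal line is `1`, so the truncation in the reference density is idle.
  have hz : ∀ᵐ z : Square, ρ z = partialMass ρ z.1 z.2 * ENNReal.ofReal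
      (Real.exp (-β * (stripMass ρ z.1 - jointCdf ρ z.1 z.2)) / expInt β (stripMass ρ z.1)) := by
    have h2' : ∀ᵐ z : Square, partialMass ρ 1 z.2 = 1 :=
      measurePreserving_snd.quasiMeasurePreserving.ae h2
    filter_upwards [h1, h2'] with z hz1 hz2
    have hle : partialMass ρ z.1 z.2 ≤ 1 := by
      rw [← hz2]
      exact lintegral_mono_set (Set.Iic_subset_Iic.2 unitInterval.le_one')
    have hle' : (partialMass ρ z.1 z.2).toReal ≤ 1 :=
      ENNReal.toReal_le_of_le_ofReal zero_le_one (by simpa using hle)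
    rw [← hz1, refDensity, min_eq_left hle', ENNReal.ofReal_mul ENNReal.toReal_nonneg,
      ENNReal.ofReal_toReal (hle.trans_lt ENNReal.one_lt_top).ne]
  have hslice : ∀ᵐ s : unitInterval, ∀ᵐ t : unitInterval, ρ (s, t) = partialMass ρ s t *
      ENNReal.ofReal (Real.exp (-β * (stripMass ρ s - jointCdf ρ s t)) /
        expInt β (stripMass ρ s)) := by
    rw [Measure.volume_eq_prod] at hz
    exact Measure.ae_ae_of_ae_prod hz
  have hfst_le : ∀ᵐ s : unitInterval, ∫⁻ t, ρ (s, t) ≤ 1 := by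
    filter_upwards [hslice] with s hs
    rw [lintegral_congr_ae hs]
    exact lintegral_partialMass_mul_le β hρ s
  have hfst_total : ∫⁻ s, ∫⁻ t, ρ (s, t) = 1 := by
    rw [← lintegral_density ρ, Measure.volume_eq_prod, lintegral_prod _ hρ.aemeasurable]
  have hfst : ∀ᵐ s : unitInterval, ∫⁻ t, ρ (s, t) = 1 :=
    ae_eq_of_ae_le_of_lintegral_le hfst_le (by rw [hfst_total]; simp) aemeasurable_const
      (by rw [hfst_total]; simp)
  have hT (s : unitInterval) : stripMass ρ s = s := by
    rw [stripMass_eq_fstMarginal hρ, measureReal_def, fstMarginal,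
      withDensity_apply _ measurableSet_Iic, lintegral_congr_ae (ae_restrict_of_ae hfst)]
    simp [s.2.1]
  simp only [hT] at hslice
  have hint (x : unitInterval) : ENNReal.ofReal (jointCdf ρ x y) = ∫⁻ s in Set.Iic x,
      ENNReal.ofReal (Real.exp (-β * s) * (expInt β (jointCdf ρ s y) *
        Real.exp (β * jointCdf ρ s y)) / expInt β s) := by
    rw [jointCdf_eq hρ, measureReal_def, ENNReal.ofReal_toReal (measure_ne_top _ _),
      withDensity_prod_apply hρ measurableSet_Iic measurableSet_Iic]
    refine lintegral_congr_ae (ae_restrict_of_ae ?_)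
    filter_upwards [hslice] with s hs
    rw [lintegral_congr_ae (ae_restrict_of_ae hs)]
    have := setLIntegral_partialMass_mul β hρ s y
    simp only [hT] at this
    exact this
  have hone : jointCdf ρ 1 y = y := by
    rw [jointCdf_eq hρ, measureReal_def, withDensity_prod_apply_symm hρ measurableSet_Iic
      measurableSet_Iic]
    have h3 := lintegral_congr_ae (ae_restrict_of_ae (s := Set.Iic y) h2)
    unfold partialMass at h3
    rw [h3]
    simp [y.2.1]
  rcases x.2.1.eq_or_lt with hx0 | hx0
  · have h3 : jointCdf ρ x y = 0 :=
      le_antisymm ((jointCdf_le_stripMass hρ x y).trans_eq ((hT x).trans hx0.symm))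
        (jointCdf_nonneg _ _)
    rw [h3, ← hx0, R_comm, R_zero_right β y.2]
  have key := expInt_eq_mul_of_integral_eq β
    (γ := fun s => jointCdf ρ (Set.projIcc 0 1 zero_le_one s) y)
    ((continuous_jointCdf_left hρ y).comp continuous_projIcc)
    (fun s _ => jointCdf_nonneg _ _)
    (fun s hs => by
      have := jointCdf_le_stripMass hρ (Set.projIcc 0 1 zero_le_one s) y
      rw [hT, Set.projIcc_of_mem zero_le_one hs] at this
      rw [Set.projIcc_of_mem zero_le_one hs]
      exact this)
    (fun x => by simpa only [Set.projIcc_val] using hint x) (x := x) ⟨hx0, x.2.2⟩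
  rw [Set.projIcc_val, Set.projIcc_right] at key
  refine (strictMono_expInt β).injective ?_
  rw [expInt_R β (expR_pos β x.2 y.2), key]
  have : jointCdf ρ ⟨1, Set.right_mem_Icc.2 zero_le_one⟩ y = y := hone
  rw [this]

end Prob

lemma ext_of_Iic_prod_Iic {μ ν : Measure Square} [IsFiniteMeasure μ] [IsFiniteMeasure ν]
    (h : ∀ x y, μ (Set.Iic x ×ˢ Set.Iic y) = ν (Set.Iic x ×ˢ Set.Iic y)) : μ = ν := by
  have hfst (κ : Measure Square) {A B : Set unitInterval} (hA : MeasurableSet A) :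
      (κ.restrict (Set.univ ×ˢ B)).map Prod.fst A = κ (A ×ˢ B) := by
    rw [Measure.map_apply measurable_fst hA, Measure.restrict_apply (measurable_fst hA)]
    congr 1; ext z; simp
  have hsnd (κ : Measure Square) {A B : Set unitInterval} (hB : MeasurableSet B) :
      (κ.restrict (A ×ˢ Set.univ)).map Prod.snd B = κ (A ×ˢ B) := by
    rw [Measure.map_apply measurable_snd hB, Measure.restrict_apply (measurable_snd hB)]
    congr 1; ext z; simp [and_comm]
  refine Measure.ext_prod fun {A B} hA hB => ?_
  rw [← hsnd μ hB, ← hsnd ν hB]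
  congr 1
  refine Measure.ext_of_Iic _ _ fun y => ?_
  rw [hsnd μ measurableSet_Iic, hsnd ν measurableSet_Iic, ← hfst μ hA, ← hfst ν hA]
  congr 1
  refine Measure.ext_of_Iic _ _ fun x => ?_
  rw [hfst μ measurableSet_Iic, hfst ν measurableSet_Iic, h]

/-! ### The minimizer -/

/-- The density `ρ_β` as a function on the square. -/
def minimizerDensity (β : ℝ) (z : Square) : ℝ≥0∞ :=
  ENNReal.ofReal (densityFormula β (z.1 : ℝ) (z.2 : ℝ))

lemma measurable_minimizerDensity (β : ℝ) : Measurable (minimizerDensity β) := by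
  have h0 : Continuous fun z : Square => ((z.1 : ℝ), (z.2 : ℝ)) := by fun_prop
  have h1 := (continuousOn_densityFormula β).comp_continuous h0 fun z => ⟨z.1.2, z.2.2⟩
  exact h1.measurable.ennreal_ofReal

lemma partialMass_minimizerDensity (β : ℝ) (x y : unitInterval) :
    partialMass (minimizerDensity β) x y = ENNReal.ofReal (derivR β x y) := by
  have h1 := setLIntegral_Iic_ofReal (f := fun s => densityFormula β s y)
    ((continuousOn_left (continuousOn_densityFormula β) y.2).integrableOn_compact isCompact_Icc)
    (fun s _ => (densityFormula_pos β s y).le) x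
  rw [integral_densityFormula β x.2 y.2] at h1
  exact h1

lemma stripMeasure_minimizerDensity (β : ℝ) (x y : unitInterval) :
    stripMeasure (minimizerDensity β) x (Set.Iic y) = ENNReal.ofReal (R β x y) := by
  have hc : ContinuousOn (fun t : ℝ => derivR β x t) (Set.Icc 0 1) :=
    continuousOn_right (f := fun p : ℝ × ℝ => derivR β p.1 p.2) (continuousOn_derivR β) x.2
  have h1 := setLIntegral_Iic_ofReal (hc.integrableOn_compact isCompact_Icc)
    (fun t _ => derivR_nonneg β x.2.1 t) y
  rw [integral_derivR β x.2 y.2] at h1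
  rw [stripMeasure, withDensity_apply _ measurableSet_Iic, ← h1]
  exact lintegral_congr fun t => partialMass_minimizerDensity β x t

lemma R_nonneg (β : ℝ) {x y : ℝ} (hx : x ∈ Set.Icc (0 : ℝ) 1) (hy : y ∈ Set.Icc (0 : ℝ) 1) :
    0 ≤ R β x y := by
  rw [← integral_derivR β hx hy]
  exact intervalIntegral.integral_nonneg hy.1 fun t _ => derivR_nonneg β hx.1 t

lemma jointCdf_minimizerDensity (β : ℝ) (x y : unitInterval) :
    jointCdf (minimizerDensity β) x y = R β x y := by
  rw [jointCdf, measureReal_def, stripMeasure_minimizerDensity,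
    ENNReal.toReal_ofReal (R_nonneg β x.2 y.2)]

lemma stripMass_minimizerDensity (β : ℝ) (x : unitInterval) :
    stripMass (minimizerDensity β) x = x := by
  rw [← jointCdf_one_right, jointCdf_minimizerDensity]
  exact R_one_right β x.2

instance isProbabilityMeasure_minimizerDensity (β : ℝ) :
    IsProbabilityMeasure ((volume : Measure Square).withDensity (minimizerDensity β)) := by
  constructor
  rw [← Set.univ_prod_univ, ← Iic_one,
    ← stripMeasure_apply (measurable_minimizerDensity β) 1 measurableSet_Iic,
    stripMeasure_minimizerDensity]
  have := R_one_right β (Set.right_mem_Icc.2 zero_le_one)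
  simpa using this

lemma partialMass_one_minimizerDensity (β : ℝ) (y : unitInterval) :
    partialMass (minimizerDensity β) 1 y = 1 := by
  rw [partialMass_minimizerDensity]
  have := derivR_one_left β y.2
  simpa using this

/-! ### Zeros of the rate function -/

lemma rateFunction_eq_zero_iff (β : ℝ) (ν : ProbabilityMeasure Square) :
    rateFunction β ν = 0 ↔ (ν : Measure Square) ≪ volume ∧
      Integrable (fun z => Real.log ((ν : Measure Square).rnDeriv volume z).toReal) ν ∧
      ∫ z, Real.log ((ν : Measure Square).rnDeriv volume z).toReal ∂(ν : Measure Square) +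
        β * energy ν + pressure β = 0 := by
  unfold rateFunction relEntropy
  split_ifs with hc
  · rw [← EReal.coe_sub, ← EReal.coe_sub, ← EReal.coe_neg, EReal.coe_eq_zero]
    constructor
    · intro h; exact ⟨hc.1, hc.2, by linarith⟩
    · rintro ⟨-, -, h⟩; linarith
  · rw [EReal.bot_sub, EReal.bot_sub, EReal.neg_bot]
    simp only [EReal.top_ne_zero, false_iff]
    rintro ⟨h1, h2, -⟩
    exact hc ⟨h1, h2⟩

/-- The probability measure with density `ρ_β`. -/
def minimizer (β : ℝ) : ProbabilityMeasure Square :=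
  ⟨(volume : Measure Square).withDensity (minimizerDensity β), inferInstance⟩

lemma eq_minimizer_of_rateFunction_eq_zero (β : ℝ) (ν : ProbabilityMeasure Square)
    (h : rateFunction β ν = 0) : ν = minimizer β := by
  obtain ⟨hac, i1, h0⟩ := (rateFunction_eq_zero_iff β ν).1 h
  have hdec : (ν : Measure Square).HaveLebesgueDecomposition volume :=
    Measure.haveLebesgueDecomposition_of_sigmaFinite _ _
  set ρ := (ν : Measure Square).rnDeriv volume with hρdef
  have hρ : Measurable ρ := Measure.measurable_rnDeriv _ _
  have hν : (ν : Measure Square) = (volume : Measure Square).withDensity ρ :=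
    (Measure.withDensity_rnDeriv_eq _ _ hac).symm
  have hP : IsProbabilityMeasure ((volume : Measure Square).withDensity ρ) := by
    rw [← hν]; infer_instance
  rw [hν] at i1 h0
  obtain ⟨h1, h2⟩ := eq_refDensity_of_freeEnergy_eq_zero β hρ i1 h0
  refine Subtype.ext ?_
  change (ν : Measure Square) = (volume : Measure Square).withDensity (minimizerDensity β)
  rw [hν]
  refine ext_of_Iic_prod_Iic fun x y => ?_
  rw [← measureReal_eq_measureReal_iff, ← jointCdf_eq hρ,
    ← jointCdf_eq (measurable_minimizerDensity β), jointCdf_minimizerDensity,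
    jointCdf_eq_R β hρ h1 h2]

lemma refDensity_minimizerDensity (β : ℝ) {z : Square} (hz : 0 < (z.1 : ℝ)) :
    refDensity β (minimizerDensity β) z = (minimizerDensity β z).toReal := by
  have h1 : partialMass (minimizerDensity β) z.1 z.2 ≤ 1 := by
    rw [← partialMass_one_minimizerDensity β z.2]
    exact lintegral_mono_set (Set.Iic_subset_Iic.2 unitInterval.le_one')
  have h2 := ENNReal.toReal_le_of_le_ofReal zero_le_one (by simpa using h1)
  rw [refDensity, min_eq_left h2, partialMass_minimizerDensity, stripMass_minimizerDensity,
    jointCdf_minimizerDensity, minimizerDensity, ENNReal.toReal_ofReal (derivR_nonneg β hz.le _),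
    ENNReal.toReal_ofReal (densityFormula_pos β _ _).le, densityFormula_eq β hz]

lemma rateFunction_minimizer (β : ℝ) : rateFunction β (minimizer β) = 0 := by
  have hm := measurable_minimizerDensity β
  set ν := (volume : Measure Square).withDensity (minimizerDensity β) with hν
  have hac : ν ≪ volume := withDensity_absolutelyContinuous _ _
  have hrn : ν.rnDeriv volume =ᵐ[ν] minimizerDensity β :=
    hac.ae_le (Measure.rnDeriv_withDensity _ hm)
  have hpos : ∀ᵐ z ∂ν, (z.1 : ℝ) ≠ 0 := by
    filter_upwards [ae_ne_of_withDensity (minimizerDensity β) 0 0] with z hz h0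
    exact hz.1 (Subtype.ext h0)
  have hlog : (fun z => Real.log (refDensity β (minimizerDensity β) z)) =ᵐ[ν]
      fun z => Real.log (ν.rnDeriv volume z).toReal := by
    filter_upwards [hrn, hpos] with z h1 h2
    rw [h1, refDensity_minimizerDensity β (lt_of_le_of_ne z.1.2.1 h2.symm)]
  have hlog' : (fun z => Real.log (refDensity β (minimizerDensity β) z)) =ᵐ[ν]
      fun z => Real.log (minimizerDensity β z).toReal := by
    filter_upwards [hpos] with z h2
    rw [refDensity_minimizerDensity β (lt_of_le_of_ne z.1.2.1 h2.symm)]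
  have h3 := freeEnergy_eq_zero_of_eq_refDensity β hm hlog'.symm
    (ae_of_all _ (partialMass_one_minimizerDensity β))
  rw [rateFunction_eq_zero_iff]
  refine ⟨hac, (integrable_and_integral_log_refDensity β hm).1.congr hlog, ?_⟩
  change ∫ z, Real.log (ν.rnDeriv volume z).toReal ∂ν + β * energy ν + pressure β = 0
  rw [← integral_congr_ae hlog, integral_congr_ae hlog']
  exact h3

end Mallows

end

theorem theorem3p5 (β : ℝ) :
    -- the limit defining the pressure exists
    Tendsto (fun n : ℕ => Mallows.finitePressure n β) atTop (𝓝 (Mallows.pressure β)) ∧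
    -- the mixed partial derivative exists and is nonnegative on the unit square
    (∀ x ∈ Set.Icc (0 : ℝ) 1, ∀ y ∈ Set.Icc (0 : ℝ) 1,
      (∀ᶠ s in 𝓝 x, DifferentiableAt ℝ (fun t => Mallows.R β s t) y) ∧
      DifferentiableAt ℝ (fun s => deriv (fun t => Mallows.R β s t) y) x ∧
      0 ≤ Mallows.density β x y) ∧
    -- it is the density of a probability measure, which is the only zero of the rate function
    ∃ νStar : ProbabilityMeasure Mallows.Square,
      (νStar : Measure Mallows.Square) =
        (volume : Measure Mallows.Square).withDensity
          (fun z => ENNReal.ofReal (Mallows.density β (z.1 : ℝ) (z.2 : ℝ))) ∧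
      ∀ ν : ProbabilityMeasure Mallows.Square, Mallows.rateFunction β ν = 0 ↔ ν = νStar := by
  refine ⟨?_, fun x hx y hy => ⟨?_, ?_, ?_⟩, Mallows.minimizer β, ?_, fun ν => ⟨?_, ?_⟩⟩
  · exact tendsto_nhds_limUnder ⟨_, Mallows.tendsto_finitePressure β⟩
  · filter_upwards [Mallows.eventually_expR_pos β hx hy] with s hs
    exact (Mallows.hasDerivAt_R β hs).differentiableAt
  · exact (Mallows.hasDerivAt_deriv_R β hx hy).differentiableAt
  · rw [Mallows.density_eq β hx hy]
    exact (Mallows.densityFormula_pos β x y).le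
  · change (volume : Measure Mallows.Square).withDensity (Mallows.minimizerDensity β) = _
    congr 1
    funext z
    rw [Mallows.density_eq β z.1.2 z.2.2, Mallows.minimizerDensity]
  · exact Mallows.eq_minimizer_of_rateFunction_eq_zero β ν
  · rintro rfl
    exact Mallows.rateFunction_minimizer β
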